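/- **Definitions.** Edges of a diagram point upwards: $r$ denotes range, $s$ source. A *separated Bratteli diagram* $(F,D)$ consists of finite non-empty vertex sets $F^{0,n}$ and edge sets $F^{1,n}$ ($n\ge 0$), surjections $r:F^{1,n}\to F^{0,n}$ and $s:F^{1,n}\to F^{0,n+1}$, and, for every vertex $v$, a partition $D_v$ of $r^{-1}(v)$ into non-empty sets. It is an *$h$-diagram* if for all $n\ge 0$: (a) $D_v=\{B_v,R_v\}$ with exactly two colours (blue $B_v$, red $R_v$, disjoint) for every $v\in F^{0,n}$; (b) $F^{0,n+1}=\bigsqcup_{v\in F^{0,n}}s(B_v)=\bigsqcup_{v\in F^{0,n}}s(R_v)$, and $s$ is injective on each $B_v$ and on each $R_v$; (c) $\bigsqcup_{e\in B_v}s(B_{s(e)})=\bigsqcup_{f\in R_v}s(R_{s(f)})$ for every $v\in F^{0,n}$. It is an *$l$-diagram* if: (a) $D_v=\{B_v,R_v\}$ for $v\in F^{0,2j}$, $j\ge0$; (b) $D_v=\{B_v\}\cup\{R(f): f\in R_{r(f)},\,s(f)=v\}$ for $v\in F^{0,2j-1}$, $j\ge 1$, where different $f$ give disjoint $R(f)$,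 and $R_v:=\bigcup_f R(f)$ (different colours being disjoint throughout); (c) for $j\ge1$, $F^{0,2j}=\bigsqcup_{v\in F^{0,2j-1}} s(B_v)=\bigsqcup_{v\in F^{0,2j-1}} s(R_v)$, and $s$ is injective on each of these $B_v$ and $R_v$; (d) $F^{0,1}=\bigsqcup_{v\in F^{0,0}}s(B_v)=\bigcup_{v\in F^{0,0}}s(R_v)$, and for each $j\ge0$ distinct blue edges of $F^{1,2j}$ have distinct sources; (e) $\bigsqcup_{e\in B_v}s(B_{s(e)})=\bigsqcup_{f\in R_v}s(R(f))$ for $v\in F^{0,2j}$, $j\ge0$; (f) for $v\in F^{0,2j-1}$, $j\ge1$, and red $f_0,f_1$ with $r(f_0)=v$, $s(f_0)=r(f_1)$ there is a unique pair of blue edges $e_0,e_1$ with $r(e_0)=v$, $s(e_0)=r(e_1)$, $s(e_1)=s(f_1)$; (g) for such $v$, each red $g$ with $s(g)=v$ and blue $e_0,e_1$ with $r(e_0)=v$, $s(e_0)=r(e_1)$, there is a unique pair of red edges $f_0\in R(g)$, $f_1$ with $r(f_0)=v$, $s(f_0)=r(f_1)$, $s(f_1)=s(e_1)$. Every $h$-diagram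 is an $l$-diagram with $R(f)=R_{s(f)}$. *Contraction* of an $l$-diagram along $m_0<m_1<\cdots$ with $m_0$ even and all $m_{n+1}-m_n$ odd: the $n$-th vertex set is $F^{0,m_n}$; the edges in layer $n$ are the paths $(e_{m_n},\dots,e_{m_{n+1}-1})$, $s(e_i)=r(e_{i+1})$, that are blue (all $e_i$ blue) or red (all $e_i$ red and $e_{i+1}\in R(e_i)$ for $i$ even), with the obvious range and source; for a red path $p$ in an even layer, $R'(p)$ consists of the red paths whose first edge lies in $R(q)$, $q$ the last edge of $p$. Let $\sim_l$ be the equivalence relation on $l$-diagrams generated by colour-preserving isomorphism (preserving the $B_v$, the $R_v$ at even layers and the labelled sets $R(f)$) and by contraction, and let $\sim_h$ be its restriction to $h$-diagrams. For a homeomorphism $\varphi$ of a non-empty totally disconnected compact metrizable space $X$, a *$\varphi$-refined sequence* is a sequence $(\mathcal P_n)_{n\ge0}$ of finite partitions of $X$ into non-empty clopen sets such that $\varphi|_Z$ is a homeomorphism onto its image for $Z\in\mathcal P_0$, $\mathcal P_{n+1}$ refines $\mathcal P_n$, $\bigcup_n\mathcal P_n$ generates the topology, the maximal diameter of the members of $\mathcal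 P_n$ (for a compatible metric) tends to $0$, $\mathcal P_{2j+1}$ refines $\mathcal P_{2j}\vee\varphi(\mathcal P_{2j})$ and $\mathcal P_{2j+2}$ refines $\mathcal P_{2j+1}\vee\varphi^{-1}(\mathcal P_{2j+1})$. Its *associated diagram* has $F^{0,n}=\mathcal P_n$, a blue edge from $Z'\in\mathcal P_{n+1}$ to $Z\in\mathcal P_n$ whenever $Z'\subseteq Z$, a red edge from $Z'$ to $Z$ whenever $Z'\subseteq\varphi(Z)$ ($n$ even), resp. $Z'\subseteq\varphi^{-1}(Z)$ ($n$ odd), and, for red $f$ in an even layer, $R(f)$ the set of red edges $g$ with $r(g)=s(f)$ and $s(g)\subseteq r(f)$. For an $h$-diagram $F$, let $X_F$ be the space of infinite blue paths $(e_0,e_1,\dots)$, $r(e_{i+1})=s(e_i)$, with the topology generated by cylinder sets, and let $\varphi_F(e_0,e_1,\dots)=(e_0',e_1',\dots)$ be the blue path for which there are red edges $f_n\in F^{1,n}$ with, for all $j\ge 0$, $r(f_{2j})=r(e_{2j})$, $s(f_{2j})=r(f_{2j+1})$, $s(f_{2j+1})=s(e_{2j+1})$, $f_{2j+1}\in R(f_{2j})$,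 and $r(e'_{2j+1})=r(f_{2j+1})$, $s(f_{2j+1})=r(f_{2j+2})$, $s(e'_{2j+2})=s(f_{2j+2})$. **Theorem.** Every homeomorphism $\varphi$ of a non-empty totally disconnected compact metrizable space $X$ admits a $\varphi$-refined sequence, and the diagram associated with any such sequence is an $h$-diagram. For every $h$-diagram $F$, the map $\varphi_F$ is well defined and is a homeomorphism of the non-empty totally disconnected compact metrizable space $X_F$. The assignments $$[(X,\varphi)]\longmapsto[\text{the associated diagram of any }\varphi\text{-refined sequence}],\qquad [F]\longmapsto[(X_F,\varphi_F)]$$ are well defined and are mutually inverse bijections between the topological conjugacy classes of homeomorphisms of non-empty totally disconnected compact metrizable spaces and the $\sim_h$-classes of $h$-diagrams. -/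

import Mathlib

universe u

namespace Diagrams

open Set Filter Topology

/-! ## Separated Bratteli diagrams with colours -/

/-- The bare data of a layered separated graph with blue and red edges. `V n` and `E n` are the
`n`-th layers of vertices and edges, an edge of `E n` goes from its source in `V (n+1)` to its
range in `V n`, and `D v` is the separation at the vertex `v`, a set of sets of edges.
`B v`, `R v` are the blue and red edges with range `v`, and `Rof f` is the set `R(f)` attached to
a red edge `f`; it has a meaning only for red `f` in an even layer. -/
structure PreDiagram where
  V : ℕ → Type u
  E : ℕ → Type u
  r : ∀ {n : ℕ}, E n → V n
  s : ∀ {n : ℕ}, E n → V (n + 1)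
  D : ∀ {n : ℕ}, V n → Set (Set (E n))
  B : ∀ {n : ℕ}, V n → Set (E n)
  R : ∀ {n : ℕ}, V n → Set (E n)
  Rof : ∀ {n : ℕ}, E n → Set (E (n + 1))

/-- `S` is the disjoint union of the indexed family `A`. -/
def IsDisjointUnion {ι α : Type*} (A : ι → Set α) (S : Set α) : Prop :=
  (⋃ i, A i) = S ∧ Pairwise fun i j => Disjoint (A i) (A j)

/-- A separated Bratteli diagram: finite non-empty layers, surjective range and source maps, and
at each vertex `v` a partition `D v` of `r⁻¹(v)` into non-empty sets. -/
structure IsSeparatedBratteli (F : PreDiagram.{u}) : Prop where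
  finite_V : ∀ n, Finite (F.V n)
  finite_E : ∀ n, Finite (F.E n)
  nonempty_V : ∀ n, Nonempty (F.V n)
  nonempty_E : ∀ n, Nonempty (F.E n)
  range_surj : ∀ n, Function.Surjective (F.r (n := n))
  source_surj : ∀ n, Function.Surjective (F.s (n := n))
  sep_nonempty : ∀ n (v : F.V n), ∀ A ∈ F.D v, A.Nonempty
  sep_disjoint : ∀ n (v : F.V n), (F.D v).PairwiseDisjoint id
  sep_union : ∀ n (v : F.V n), ⋃₀ F.D v = {e | F.r e = v}

/-- `l`-diagrams. The odd layers `2j - 1`, `j ≥ 1`, are written `2j + 1`, `j ≥ 0`. -/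
structure IsLDiagram (F : PreDiagram.{u}) : Prop extends IsSeparatedBratteli F where
  /-- Separations at even layers. -/
  sep_even : ∀ j (v : F.V (2 * j)), F.D v = {F.B v, F.R v}
  /-- Separations at odd layers: one colour `R(f)` for each red edge `f` with source `v`. -/
  sep_odd : ∀ j (v : F.V (2 * j + 1)),
    F.D v = {F.B v} ∪ {A | ∃ f : F.E (2 * j), f ∈ F.R (F.r f) ∧ F.s f = v ∧ A = F.Rof f}
  red_odd : ∀ j (v : F.V (2 * j + 1)),
    F.R v = {g | ∃ f : F.E (2 * j), f ∈ F.R (F.r f) ∧ F.s f = v ∧ g ∈ F.Rof f}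
  /-- Different colours are different members of the separation. -/
  blue_red : ∀ n (v : F.V n), Disjoint (F.B v) (F.R v)
  red_red : ∀ j (f f' : F.E (2 * j)), f ∈ F.R (F.r f) → f' ∈ F.R (F.r f') → F.s f = F.s f' →
    f ≠ f' → Disjoint (F.Rof f) (F.Rof f')
  /-- Vertices at even layers. -/
  even_blue : ∀ j, IsDisjointUnion (fun v : F.V (2 * j + 1) => F.s '' F.B v) univ
  even_red : ∀ j, IsDisjointUnion (fun v : F.V (2 * j + 1) => F.s '' F.R v) univ
  even_blue_inj : ∀ j (v : F.V (2 * j + 1)), InjOn F.s (F.B v)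
  even_red_inj : ∀ j (v : F.V (2 * j + 1)), InjOn F.s (F.R v)
  /-- Vertices at the first odd layer. -/
  first_blue : IsDisjointUnion (fun v : F.V 0 => F.s '' F.B v) univ
  first_red : (⋃ v : F.V 0, F.s '' F.R v) = univ
  odd_blue_inj : ∀ j (v₁ v₂ : F.V (2 * j)), ∀ e ∈ F.B v₁, ∀ e' ∈ F.B v₂, e ≠ e' → F.s e ≠ F.s e'
  /-- Compatibility at even layers. -/
  compat : ∀ j (v : F.V (2 * j)), ∃ S : Set (F.V (2 * j + 2)),
    IsDisjointUnion (fun e : F.B v => F.s '' F.B (F.s e.1)) S ∧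
    IsDisjointUnion (fun f : F.R v => F.s '' F.Rof f.1) S
  /-- Rombs at odd layers, red edges. -/
  romb_red : ∀ j (v : F.V (2 * j + 1)) (f₀ : F.E (2 * j + 1)) (f₁ : F.E (2 * j + 2)),
    f₀ ∈ F.R (F.r f₀) → f₁ ∈ F.R (F.r f₁) → F.r f₀ = v → F.s f₀ = F.r f₁ →
    ∃! e : F.E (2 * j + 1) × F.E (2 * j + 2),
      e.1 ∈ F.B (F.r e.1) ∧ e.2 ∈ F.B (F.r e.2) ∧
      F.r e.1 = v ∧ F.s e.1 = F.r e.2 ∧ F.s e.2 = F.s f₁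
  /-- Rombs at odd layers, blue edges. -/
  romb_blue : ∀ j (v : F.V (2 * j + 1)) (g : F.E (2 * j))
    (e₀ : F.E (2 * j + 1)) (e₁ : F.E (2 * j + 2)),
    g ∈ F.R (F.r g) → F.s g = v →
    e₀ ∈ F.B (F.r e₀) → e₁ ∈ F.B (F.r e₁) → F.r e₀ = v → F.s e₀ = F.r e₁ →
    ∃! f : F.E (2 * j + 1) × F.E (2 * j + 2),
      f.1 ∈ F.R (F.r f.1) ∧ f.2 ∈ F.R (F.r f.2) ∧ f.1 ∈ F.Rof g ∧
      F.r f.1 = v ∧ F.s f.1 = F.r f.2 ∧ F.s f.2 = F.s e₁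

/-- `h`-diagrams: separated Bratteli diagrams with exactly two colours at each vertex. -/
structure IsHDiagram (F : PreDiagram.{u}) : Prop extends IsSeparatedBratteli F where
  sep : ∀ n (v : F.V n), F.D v = {F.B v, F.R v}
  blue_red : ∀ n (v : F.V n), Disjoint (F.B v) (F.R v)
  /-- Vertices. -/
  vert_blue : ∀ n, IsDisjointUnion (fun v : F.V n => F.s '' F.B v) univ
  vert_red : ∀ n, IsDisjointUnion (fun v : F.V n => F.s '' F.R v) univ
  blue_inj : ∀ n (v : F.V n), InjOn F.s (F.B v)
  red_inj : ∀ n (v : F.V n), InjOn F.s (F.R v)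
  /-- Compatibility. -/
  compat : ∀ n (v : F.V n), ∃ S : Set (F.V (n + 2)),
    IsDisjointUnion (fun e : F.B v => F.s '' F.B (F.s e.1)) S ∧
    IsDisjointUnion (fun f : F.R v => F.s '' F.R (F.s f.1)) S
  /-- Not a condition on the `h`-diagram, which has no sets `R(f)`: it fixes the value that `Rof`
  takes when the `h`-diagram is regarded as an `l`-diagram. -/
  label : ∀ j (f : F.E (2 * j)), f ∈ F.R (F.r f) → F.Rof f = F.R (F.s f)

section HDiagramIsLDiagram

variable {F : PreDiagram.{u}}

theorem IsHDiagram.range_blue (h : IsHDiagram F) {n : ℕ} {v : F.V n} {e : F.E n}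
    (he : e ∈ F.B v) : F.r e = v := by
  have : e ∈ ⋃₀ F.D v := ⟨F.B v, by rw [h.sep]; simp, he⟩
  rwa [h.sep_union] at this

theorem IsHDiagram.range_red (h : IsHDiagram F) {n : ℕ} {v : F.V n} {e : F.E n}
    (he : e ∈ F.R v) : F.r e = v := by
  have : e ∈ ⋃₀ F.D v := ⟨F.R v, by rw [h.sep]; simp, he⟩
  rwa [h.sep_union] at this

theorem IsHDiagram.blue_unique (h : IsHDiagram F) {n : ℕ} {v w : F.V n} {e e' : F.E n}
    (he : e ∈ F.B v) (he' : e' ∈ F.B w) (hs : F.s e = F.s e') : e = e' := by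
  by_cases hvw : v = w
  · subst hvw
    exact h.blue_inj n v he he' hs
  · exact absurd ⟨e', he', hs.symm⟩
      (Set.disjoint_left.1 ((h.vert_blue n).2 hvw) ⟨e, he, rfl⟩)

theorem IsHDiagram.red_unique (h : IsHDiagram F) {n : ℕ} {v w : F.V n} {e e' : F.E n}
    (he : e ∈ F.R v) (he' : e' ∈ F.R w) (hs : F.s e = F.s e') : e = e' := by
  by_cases hvw : v = w
  · subst hvw
    exact h.red_inj n v he he' hs
  · exact absurd ⟨e', he', hs.symm⟩
      (Set.disjoint_left.1 ((h.vert_red n).2 hvw) ⟨e, he, rfl⟩)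

theorem IsHDiagram.exists_red (h : IsHDiagram F) {n : ℕ} (w : F.V (n + 1)) :
    ∃ f : F.E n, f ∈ F.R (F.r f) ∧ F.s f = w := by
  have : w ∈ ⋃ v : F.V n, F.s '' F.R v := by rw [(h.vert_red n).1]; trivial
  obtain ⟨v, f, hf, hs⟩ := Set.mem_iUnion.1 this
  exact ⟨f, by rwa [h.range_red hf], hs⟩

/-- Every `h`-diagram is an `l`-diagram. -/
theorem IsHDiagram.isLDiagram (h : IsHDiagram F) : IsLDiagram F where
  toIsSeparatedBratteli := h.toIsSeparatedBratteli
  sep_even j v := h.sep _ v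
  sep_odd j v := by
    rw [h.sep]
    ext A
    simp only [mem_insert_iff, mem_singleton_iff, mem_union, mem_ofPred_eq]
    refine or_congr_right ⟨fun hA => ?_, ?_⟩
    · obtain ⟨f, hf, hs⟩ := h.exists_red v
      exact ⟨f, hf, hs, by rw [hA, h.label j f hf, hs]⟩
    · rintro ⟨f, hf, hs, rfl⟩
      rw [h.label j f hf, hs]
  red_odd j v := by
    ext g
    constructor
    · intro hg
      obtain ⟨f, hf, hs⟩ := h.exists_red v
      exact ⟨f, hf, hs, by rwa [h.label j f hf, hs]⟩
    · rintro ⟨f, hf, hs, hg⟩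
      rwa [h.label j f hf, hs] at hg
  blue_red := h.blue_red
  red_red j f f' hf hf' hs hne := absurd (h.red_unique hf hf' hs) hne
  even_blue j := h.vert_blue _
  even_red j := h.vert_red _
  even_blue_inj j v := h.blue_inj _ v
  even_red_inj j v := h.red_inj _ v
  first_blue := h.vert_blue 0
  first_red := (h.vert_red 0).1
  odd_blue_inj j v₁ v₂ e he e' he' hne hs := hne (h.blue_unique he he' hs)
  compat j v := by
    obtain ⟨S, hB, hR⟩ := h.compat _ v
    refine ⟨S, hB, ?_⟩
    have : (fun f : F.R v => F.s '' F.Rof f.1) = fun f : F.R v => F.s '' F.R (F.s f.1) := by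
      funext f
      have hf : f.1 ∈ F.R (F.r f.1) := by rw [h.range_red f.2]; exact f.2
      rw [h.label j f.1 hf]
    rwa [this]
  romb_red j v f₀ f₁ h₀ h₁ hr hs := by
    obtain ⟨S, hB, hR⟩ := h.compat _ v
    have hS : F.s f₁ ∈ S := by
      rw [← hR.1]
      exact Set.mem_iUnion.2 ⟨⟨f₀, hr ▸ h₀⟩, f₁, hs ▸ h₁, rfl⟩
    rw [← hB.1] at hS
    obtain ⟨⟨e₀, he₀⟩, e₁, he₁, hse⟩ := Set.mem_iUnion.1 hS
    have hre₀ := h.range_blue he₀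
    have hre₁ := h.range_blue he₁
    refine ⟨(e₀, e₁), ⟨?_, ?_, hre₀, hre₁.symm, hse⟩, ?_⟩
    · rw [hre₀]; exact he₀
    · rw [hre₁]; exact he₁
    · rintro ⟨a, b⟩ ⟨ha, hb, -, hab, hsb⟩
      have hbe : b = e₁ := h.blue_unique hb he₁ (hsb.trans hse.symm)
      subst hbe
      have hae : a = e₀ := h.blue_unique ha he₀ (hab.trans hre₁)
      rw [hae]
  romb_blue j v g e₀ e₁ hg hgv h₀ h₁ hr hs := by
    obtain ⟨S, hB, hR⟩ := h.compat _ v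
    have hS : F.s e₁ ∈ S := by
      rw [← hB.1]
      exact Set.mem_iUnion.2 ⟨⟨e₀, hr ▸ h₀⟩, e₁, hs ▸ h₁, rfl⟩
    rw [← hR.1] at hS
    obtain ⟨⟨f₀, hf₀⟩, f₁, hf₁, hsf⟩ := Set.mem_iUnion.1 hS
    have hrf₀ := h.range_red hf₀
    have hrf₁ := h.range_red hf₁
    refine ⟨(f₀, f₁), ⟨?_, ?_, ?_, hrf₀, hrf₁.symm, hsf⟩, ?_⟩
    · rw [hrf₀]; exact hf₀
    · rw [hrf₁]; exact hf₁
    · rw [h.label j g hg, hgv]; exact hf₀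
    · rintro ⟨a, b⟩ ⟨ha, hb, -, -, hab, hsb⟩
      have hbe : b = f₁ := h.red_unique hb hf₁ (hsb.trans hsf.symm)
      subst hbe
      have hae : a = f₀ := h.red_unique ha hf₀ (hab.trans hrf₁)
      rw [hae]

end HDiagramIsLDiagram

/-! ## Isomorphism and contraction -/

/-- Isomorphism of separated diagrams preserving the colours (and the layers, which are
determined by the graph). -/
structure PreDiagram.Iso (F G : PreDiagram.{u}) where
  vert : ∀ n, F.V n ≃ G.V n
  edge : ∀ n, F.E n ≃ G.E n
  map_r : ∀ n (e : F.E n), G.r (edge n e) = vert n (F.r e)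
  map_s : ∀ n (e : F.E n), G.s (edge n e) = vert (n + 1) (F.s e)
  map_D : ∀ n (v : F.V n), (fun A => edge n '' A) '' F.D v = G.D (vert n v)
  map_B : ∀ n (v : F.V n), edge n '' F.B v = G.B (vert n v)
  map_R : ∀ j (v : F.V (2 * j)), edge (2 * j) '' F.R v = G.R (vert (2 * j) v)
  map_Rof : ∀ j (f : F.E (2 * j)), f ∈ F.R (F.r f) →
    edge (2 * j + 1) '' F.Rof f = G.Rof (edge (2 * j) f)

/-- The separation prescribed by the colours: `{B_v, R_v}` at the even layers and
`{B_v} ∪ {R(f) : f red, s(f) = v}` at the odd layers. -/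
def colourSep (V E : ℕ → Type u) (r : ∀ {n : ℕ}, E n → V n) (s : ∀ {n : ℕ}, E n → V (n + 1))
    (B R : ∀ {n : ℕ}, V n → Set (E n)) (Rof : ∀ {n : ℕ}, E n → Set (E (n + 1))) :
    ∀ {n : ℕ}, V n → Set (Set (E n))
  | 0, v => {B v, R v}
  | k + 1, v => {A | A = B v ∨ (Even (k + 1) ∧ A = R v) ∨
      (Odd (k + 1) ∧ ∃ f : E k, f ∈ R (r f) ∧ s f = v ∧ A = Rof f)}

/-- Finite paths `(e_j, …, e_{l-1})` with `s(e_i) = r(e_{i+1})`, recorded together with the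
vertices they pass through. -/
@[ext]
structure PreDiagram.Path (F : PreDiagram.{u}) (j l : ℕ) where
  vert : ∀ i, j ≤ i → i ≤ l → F.V i
  edge : ∀ i, j ≤ i → i < l → F.E i
  range_eq : ∀ i (hj : j ≤ i) (hl : i < l), F.r (edge i hj hl) = vert i hj hl.le
  source_eq : ∀ i (hj : j ≤ i) (hl : i < l),
    F.s (edge i hj hl) = vert (i + 1) (Nat.le_succ_of_le hj) hl

/-- All edges of the path are blue. -/
def PreDiagram.Path.IsBlue {F : PreDiagram.{u}} {j l : ℕ} (p : F.Path j l) : Prop :=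
  ∀ i hj hl, p.edge i hj hl ∈ F.B (F.r (p.edge i hj hl))

/-- All edges `f_i` of the path are red, and `f_{i+1} ∈ R(f_i)` for even `i`. -/
def PreDiagram.Path.IsRed {F : PreDiagram.{u}} {j l : ℕ} (p : F.Path j l) : Prop :=
  (∀ i hj hl, p.edge i hj hl ∈ F.R (F.r (p.edge i hj hl))) ∧
  ∀ i (hj : j ≤ i) (hl : i + 1 < l), Even i →
    p.edge (i + 1) (Nat.le_succ_of_le hj) hl ∈ F.Rof (p.edge i hj (Nat.lt_of_succ_lt hl))

/-- The sequences `m₀ < m₁ < ⋯` along which diagrams are contracted. -/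
structure ContractionSeq where
  m : ℕ → ℕ
  strictMono : StrictMono m
  even_zero : Even (m 0)
  odd_gap : ∀ n, m (n + 1) - m n ≡ 1 [MOD 2]

theorem ContractionSeq.lt (m : ContractionSeq) (n : ℕ) : m.m n < m.m (n + 1) :=
  m.strictMono n.lt_succ_self

section Contraction

variable (F : PreDiagram.{u}) (m : ContractionSeq)

/-- Edges of the contraction: disjoint union of the blue and the red paths. -/
def ContractedEdge (n : ℕ) : Type u :=
  {p : F.Path (m.m n) (m.m (n + 1)) // p.IsBlue} ⊕ {p : F.Path (m.m n) (m.m (n + 1)) // p.IsRed}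

variable {F m}

/-- The path underlying an edge of the contraction. -/
def ContractedEdge.path {n : ℕ} : ContractedEdge F m n → F.Path (m.m n) (m.m (n + 1))
  | Sum.inl p => p.1
  | Sum.inr p => p.1

def ContractedEdge.r {n : ℕ} (e : ContractedEdge F m n) : F.V (m.m n) :=
  e.path.vert (m.m n) le_rfl (m.lt n).le

def ContractedEdge.s {n : ℕ} (e : ContractedEdge F m n) : F.V (m.m (n + 1)) :=
  e.path.vert (m.m (n + 1)) (m.lt n).le le_rfl

def ContractedEdge.B {n : ℕ} (v : F.V (m.m n)) : Set (ContractedEdge F m n) :=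
  {e | e.isLeft ∧ e.r = v}

def ContractedEdge.R {n : ℕ} (v : F.V (m.m n)) : Set (ContractedEdge F m n) :=
  {e | e.isRight ∧ e.r = v}

/-- `R'(f)` for a red path `f`: the red paths whose first edge belongs to `R(f')`, where `f'` is
the last edge of `f`. -/
def ContractedEdge.Rof {n : ℕ} (f : ContractedEdge F m n) : Set (ContractedEdge F m (n + 1)) :=
  {g | f.isRight ∧ g.isRight ∧ ∃ (i : ℕ) (h₁ : m.m n ≤ i) (h₂ : i + 1 = m.m (n + 1)),
    g.path.edge (i + 1) h₂.ge (h₂ ▸ m.lt (n + 1)) ∈ F.Rof (f.path.edge i h₁ (h₂ ▸ i.lt_succ_self))}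

variable (F m)

/-- The contraction (telescoping) of a diagram along a sequence. -/
def PreDiagram.contract : PreDiagram.{u} where
  V n := F.V (m.m n)
  E n := ContractedEdge F m n
  r := ContractedEdge.r
  s := ContractedEdge.s
  D := colourSep (fun n => F.V (m.m n)) (ContractedEdge F m) ContractedEdge.r ContractedEdge.s
    ContractedEdge.B ContractedEdge.R ContractedEdge.Rof
  B := ContractedEdge.B
  R := ContractedEdge.R
  Rof := ContractedEdge.Rof

end Contraction

/-- The class of `l`-diagrams. -/
def LDiag : Type (u + 1) := {F : PreDiagram.{u} // IsLDiagram F}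

/-- The class of `h`-diagrams. -/
def HDiag : Type (u + 1) := {F : PreDiagram.{u} // IsHDiagram F}

def HDiag.toLDiag (F : HDiag.{u}) : LDiag.{u} := ⟨F.1, F.2.isLDiagram⟩

/-- The equivalence relation on `l`-diagrams generated by isomorphism and contraction. -/
instance LDiag.setoid : Setoid LDiag.{u} :=
  Relation.EqvGen.setoid fun F G => Nonempty (F.1.Iso G.1) ∨ ∃ m, G.1 = F.1.contract m

/-- The restriction of the equivalence of `l`-diagrams to the `h`-diagrams. -/
instance HDiag.setoid : Setoid HDiag.{u} := LDiag.setoid.comap HDiag.toLDiag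

/-! ## Dynamical systems -/

/-- `σ` is a surjective local homeomorphism of the totally disconnected compact metrizable
(non-empty) space `X`. -/
structure IsLHomeo (X : Type u) [TopologicalSpace X] (σ : X → X) : Prop where
  nonempty : Nonempty X
  compact : CompactSpace X
  metrizable : TopologicalSpace.MetrizableSpace X
  totallyDisconnected : TotallyDisconnectedSpace X
  isLocalHomeomorph : IsLocalHomeomorph σ
  surjective : Function.Surjective σ

/-- The class of surjective local homeomorphisms of totally disconnected compact metrizable
spaces. -/
structure LHomeo where
  X : Type u
  [top : TopologicalSpace X]
  σ : X → X
  isLHomeo : IsLHomeo X σ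

attribute [instance] LHomeo.top

/-- The subclass of homeomorphisms. -/
def Homeo : Type (u + 1) := {S : LHomeo.{u} // IsHomeomorph S.σ}

/-- Topological conjugacy. -/
def LHomeo.Conj (S T : LHomeo.{u}) : Prop := ∃ h : S.X ≃ₜ T.X, h ∘ S.σ = T.σ ∘ h

instance LHomeo.setoid : Setoid LHomeo.{u} where
  r := LHomeo.Conj
  iseqv :=
    { refl := fun S => ⟨Homeomorph.refl _, rfl⟩
      symm := by
        rintro S T ⟨h, hh⟩
        refine ⟨h.symm, funext fun y => ?_⟩
        have := congrFun hh (h.symm y)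
        simp only [Function.comp_apply, Homeomorph.apply_symm_apply] at this
        simp [← this]
      trans := by
        rintro S T U ⟨h, hh⟩ ⟨k, hk⟩
        refine ⟨h.trans k, funext fun x => ?_⟩
        have h₁ := congrFun hh x
        have h₂ := congrFun hk (h x)
        simp only [Function.comp_apply] at h₁ h₂
        simp [h₁, h₂] }

/-- Topological conjugacy of homeomorphisms. -/
instance Homeo.setoid : Setoid Homeo.{u} := LHomeo.setoid.comap Subtype.val

/-! ## From systems to diagrams -/

section Partitions

variable {X : Type u}

/-- Partitions of a space into finitely many non-empty clopen sets. -/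
structure IsClopenPartition [TopologicalSpace X] (P : Set (Set X)) : Prop where
  finite : P.Finite
  nonempty : ∀ Z ∈ P, Z.Nonempty
  clopen : ∀ Z ∈ P, IsClopen Z
  disjoint : P.PairwiseDisjoint id
  union : ⋃₀ P = univ

/-- `Q` is finer than `P`. -/
def Refines (P Q : Set (Set X)) : Prop := ∀ Z ∈ Q, ∃ Z' ∈ P, Z ⊆ Z'

/-- `P ∨ Q`. -/
def wedge (P Q : Set (Set X)) : Set (Set X) :=
  {W | W.Nonempty ∧ ∃ Z₁ ∈ P, ∃ Z₂ ∈ Q, W = Z₁ ∩ Z₂}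

/-- The points with at least `k` preimages. -/
def atLeast (σ : X → X) (k : ℕ) : Set X := {x | (k : ℕ∞) ≤ (σ ⁻¹' {x}).encard}

/-- The partition `P^σ`: the non-empty sets among `σ(Z₁) ∩ ⋯ ∩ σ(Z_k) \ atLeast σ (k+1)` for
pairwise different `Z₁, …, Z_k ∈ P`, `k ≥ 1`. If `σ` is injective on the members of `P`, then
such a set is empty as soon as `k` exceeds the number of preimages of every point. -/
def forwardPartition (σ : X → X) (P : Set (Set X)) : Set (Set X) :=
  {W | W.Nonempty ∧ ∃ T : Finset (Set X), T.Nonempty ∧ (∀ Z ∈ T, Z ∈ P) ∧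
    W = (⋂ Z ∈ T, σ '' Z) \ atLeast σ (T.card + 1)}

/-- `σ⁻¹(P)`. -/
def backwardPartition (σ : X → X) (P : Set (Set X)) : Set (Set X) := (fun Z => σ ⁻¹' Z) '' P

/-- The diameter of a partition, for a metric that induces the topology. -/
noncomputable def partitionDiam [TopologicalSpace X] [TopologicalSpace.MetrizableSpace X]
    (P : Set (Set X)) : ℝ :=
  letI := TopologicalSpace.metrizableSpaceMetric X
  sSup (Metric.diam '' P)

/-- `σ`-refined sequences of partitions. -/
structure IsRefinedSeq [t : TopologicalSpace X] [TopologicalSpace.MetrizableSpace X] (σ : X → X)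
    (P : ℕ → Set (Set X)) : Prop where
  partition : ∀ n, IsClopenPartition (P n)
  homeo : ∀ Z ∈ P 0, IsEmbedding (Z.domRestrict σ)
  refines : ∀ n, Refines (P n) (P (n + 1))
  generates : t = TopologicalSpace.generateFrom (⋃ n, P n)
  diam : Tendsto (fun n => partitionDiam (P n)) atTop (𝓝 0)
  even : ∀ j, Refines (wedge (P (2 * j)) (forwardPartition σ (P (2 * j)))) (P (2 * j + 1))
  odd : ∀ j, Refines (wedge (P (2 * j + 1)) (backwardPartition σ (P (2 * j + 1)))) (P (2 * j + 2))

/-- Edges of the diagram of a sequence of partitions. The left summand holds the blue edges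
`Z' → Z`, for `Z' ∈ P (n+1)`, `Z ∈ P n` with `Z' ⊆ Z`. The right summand holds the red edges
`Z' → Z`, with `Z' ⊆ σ(Z)` if `n` is even and `Z' ⊆ σ⁻¹(Z)` if `n` is odd. -/
def PartitionEdge (σ : X → X) (P : ℕ → Set (Set X)) (n : ℕ) : Type u :=
  {p : P (n + 1) × P n // p.1.1 ⊆ p.2.1} ⊕
  {p : P (n + 1) × P n //
    (Even n → p.1.1 ⊆ σ '' p.2.1) ∧ (Odd n → p.1.1 ⊆ σ ⁻¹' p.2.1)}

variable {σ : X → X} {P : ℕ → Set (Set X)}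

def PartitionEdge.r {n : ℕ} : PartitionEdge σ P n → P n
  | Sum.inl p => p.1.2
  | Sum.inr p => p.1.2

def PartitionEdge.s {n : ℕ} : PartitionEdge σ P n → P (n + 1)
  | Sum.inl p => p.1.1
  | Sum.inr p => p.1.1

def PartitionEdge.B {n : ℕ} (Z : P n) : Set (PartitionEdge σ P n) := {e | e.isLeft ∧ e.r = Z}

def PartitionEdge.R {n : ℕ} (Z : P n) : Set (PartitionEdge σ P n) := {e | e.isRight ∧ e.r = Z}

/-- `R(f)`: the red edges `g` with `r(g) = s(f)` and `s(g) ⊆ r(f)`. -/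
def PartitionEdge.Rof {n : ℕ} (f : PartitionEdge σ P n) : Set (PartitionEdge σ P (n + 1)) :=
  {g | f.isRight ∧ g.isRight ∧ g.r = f.s ∧ g.s.1 ⊆ f.r.1}

variable (σ P)

/-- The diagram constructed from a map and a sequence of partitions. -/
def partitionDiagram : PreDiagram.{u} where
  V n := P n
  E n := PartitionEdge σ P n
  r := PartitionEdge.r
  s := PartitionEdge.s
  D := colourSep (fun n => P n) (PartitionEdge σ P) PartitionEdge.r PartitionEdge.s
    PartitionEdge.B PartitionEdge.R PartitionEdge.Rof
  B := PartitionEdge.B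
  R := PartitionEdge.R
  Rof := PartitionEdge.Rof

end Partitions

/-! ## From diagrams to systems -/

/-- The space of infinite blue paths `(e₀, e₁, …)`. -/
def PreDiagram.PathSpace (F : PreDiagram.{u}) : Type u :=
  {e : ∀ n, F.E n // ∀ n, e n ∈ F.B (F.r (e n)) ∧ F.r (e (n + 1)) = F.s (e n)}

/-- The cylinder set `Z(x₀, …, x_n)`. -/
def PreDiagram.cylinder (F : PreDiagram.{u}) (x : F.PathSpace) (n : ℕ) : Set F.PathSpace :=
  {y | ∀ i ≤ n, y.1 i = x.1 i}

/-- The topology generated by the cylinder sets. -/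
instance (F : PreDiagram.{u}) : TopologicalSpace F.PathSpace :=
  TopologicalSpace.generateFrom {Z | ∃ x n, Z = F.cylinder x n}

/-- `y = (e₀', e₁', …)` is the image of `x = (e₀, e₁, …)` under the map attached to the diagram:
there are red edges `f₀, f₁, …` such that `(e_{2j}, e_{2j+1}, f_{2j}, f_{2j+1})` is the romb on the
blue pair `(e_{2j}, e_{2j+1})` and `(e'_{2j+1}, e'_{2j+2}, f_{2j+1}, f_{2j+2})` is the romb on the
red pair `(f_{2j+1}, f_{2j+2})`; the edge `e₀'` is then the blue edge with `s(e₀') = r(e₁')`. -/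
def PreDiagram.MapsTo (F : PreDiagram.{u}) (x y : F.PathSpace) : Prop :=
  ∃ f : ∀ n, F.E n, (∀ n, f n ∈ F.R (F.r (f n))) ∧
    (∀ j, F.r (f (2 * j)) = F.r (x.1 (2 * j)) ∧
      F.s (f (2 * j)) = F.r (f (2 * j + 1)) ∧
      F.s (f (2 * j + 1)) = F.s (x.1 (2 * j + 1)) ∧
      f (2 * j + 1) ∈ F.Rof (f (2 * j))) ∧
    (∀ j, F.r (y.1 (2 * j + 1)) = F.r (f (2 * j + 1)) ∧
      F.s (f (2 * j + 1)) = F.r (f (2 * j + 2)) ∧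
      F.s (y.1 (2 * j + 2)) = F.s (f (2 * j + 2)))

end Diagrams

open Diagrams

/-!
# Homeomorphisms of totally disconnected spaces and `h`-diagrams

An `h`-diagram is a tower of finite sets `V 0 ← V 1 ← V 2 ← ⋯` with two families of surjections
`b, ρ : V (n + 1) → V n`, the ranges of the blue and of the red edge with a given source, such
that `b ∘ b = ρ ∘ ρ` (`isHDiagram_of`, `IsHDiagram.bluePar_bluePar`). Bijections between the
vertices that commute with `b` and `ρ` extend to isomorphisms (`IsHDiagram.nonempty_iso`).
The path space `X_F` is the inverse limit of `(V, b)`, and `y = φ_F x` means `y_n = ρ (x_{n+1})`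
for all odd `n`, equivalently `x_n = ρ (y_{n+1})` for all even `n`; hence `φ_F` is a homeomorphism
(`IsHDiagram.exists_homeomorph`).

The map `F ↦ (X_F, φ_F)` induces a bijection of classes for three reasons.

* It is well defined. Two equivalent `h`-diagrams may be joined by `l`-diagrams only, for which
  the graph `MapsTo` of the map is used in place of the map. In an `l`-diagram blue edges, and red
  edges in odd layers, are determined by their sources, and `MapsTo x y` says that the red edge
  with source `x_{n+1}` has range `y_n` for odd `n`. By the romb conditions this for one odd `n`
  implies it for all smaller ones (`IsLDiagram.mapsTo_of_frequently`), so a contraction, which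
  sees only a subsequence of the layers, does not lose information
  (`IsLDiagram.pathConj_contract`).
* It is surjective: a homeomorphism has a refined sequence of partitions (`exists_isTower`), and
  sending a point to the sequence of the sets that contain it conjugates the homeomorphism to the
  path system of the associated diagram (`IsTower.exists_homeomorph`).
* It is injective. Let `X_F` and `X_G` be conjugate. The sets of paths through the vertices of `F`,
  and of `G`, give two refined sequences on `X_F` with diagrams `F` and `G`
  (`exists_isTower_iso`). Contracting the diagram of a refined sequence amounts to passing to a
  subsequence (`IsTower.nonempty_iso_contract`), and any two refined sequences have subsequences
  that are also subsequences of a third one (`IsTower.hDiag_equiv`).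
-/

namespace Diagrams

open Set Filter Topology

/-! ### Descending along a tower of maps -/

section Descend

variable {V : ℕ → Type*} (g : ∀ n, V (n + 1) → V n)

/-- The image of `w : V j` in `V i`, `i ≤ j`, under the composite of the maps of the tower `g`. -/
def descend {j : ℕ} (w : V j) (i : ℕ) (h : i ≤ j) : V i :=
  Nat.decreasingInduction (motive := fun i _ => V i) (fun i _ v => g i v) w h

theorem descend_self {j : ℕ} (w : V j) : descend g w j le_rfl = w :=
  Nat.decreasingInduction_self ..

theorem descend_of_lt {i j : ℕ} (w : V j) (h : i + 1 ≤ j) :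
    descend g w i (Nat.le_of_succ_le h) = g i (descend g w (i + 1) h) :=
  Nat.decreasingInduction_succ_left ..

theorem descend_succ {i j : ℕ} (w : V (j + 1)) (h : i ≤ j) :
    descend g w i (Nat.le_succ_of_le h) = descend g (g j w) i h :=
  Nat.decreasingInduction_succ ..

theorem descend_eq {a l : ℕ} (v : ∀ i, a ≤ i → i ≤ l → V i)
    (hv : ∀ i (ha : a ≤ i) (hl : i + 1 ≤ l),
      g i (v (i + 1) (Nat.le_succ_of_le ha) hl) = v i ha (Nat.le_of_succ_le hl))
    {i j : ℕ} (ha : a ≤ i) (hij : i ≤ j) (hl : j ≤ l) :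
    descend g (v j (ha.trans hij) hl) i hij = v i ha (hij.trans hl) := by
  induction j, hij using Nat.le_induction with
  | base => exact descend_self ..
  | succ j hij ih => rw [descend_succ g _ hij, hv j (ha.trans hij) hl, ih]

theorem descend_descend {i j k : ℕ} (w : V k) (hij : i ≤ j) (hjk : j ≤ k) :
    descend g (descend g w j hjk) i hij = descend g w i (hij.trans hjk) :=
  descend_eq g (a := i) (l := k) (fun i _ hl => descend g w i hl)
    (fun _ _ hl => (descend_of_lt g w hl).symm) le_rfl hij hjk

theorem descend_seq (v : ∀ i, V i) (hv : ∀ i, g i (v (i + 1)) = v i) {i j : ℕ} (h : i ≤ j) :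
    descend g (v j) i h = v i :=
  descend_eq g (a := 0) (l := j) (fun i _ _ => v i) (fun i _ _ => hv i) (Nat.zero_le i) h le_rfl

theorem descend_surjective (hg : ∀ n, Function.Surjective (g n)) {i j : ℕ} (h : i ≤ j) :
    Function.Surjective fun w : V j => descend g w i h := by
  induction j, h using Nat.le_induction with
  | base => exact fun w => ⟨w, descend_self g w⟩
  | succ j h ih =>
    intro v
    obtain ⟨w, hw⟩ := ih v
    obtain ⟨w', rfl⟩ := hg j w
    exact ⟨w', (descend_succ g w' h).trans hw⟩

/-- Towers with `b ∘ b = ρ ∘ ρ` have the same descents over even distances. -/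
theorem descend_add_two_mul (b ρ : ∀ n, V (n + 1) → V n)
    (h : ∀ n w, b n (b (n + 1) w) = ρ n (ρ (n + 1) w)) (i k : ℕ) (w : V (i + 2 * k)) :
    descend b w i (Nat.le_add_right ..) = descend ρ w i (Nat.le_add_right ..) := by
  induction k with
  | zero => exact (descend_self b w).trans (descend_self ρ w).symm
  | succ k ih =>
    have hb : descend b w i (Nat.le_add_right ..) =
        descend b (b _ (b _ w)) i (Nat.le_add_right i (2 * k)) :=
      (descend_succ b w (j := i + 2 * k + 1) (by omega)).trans (descend_succ b _ (by omega))
    have hρ : descend ρ w i (Nat.le_add_right ..) =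
        descend ρ (ρ _ (ρ _ w)) i (Nat.le_add_right i (2 * k)) :=
      (descend_succ ρ w (j := i + 2 * k + 1) (by omega)).trans (descend_succ ρ _ (by omega))
    rw [hb, hρ, h]
    exact ih _

theorem descend_eq_of_even (b ρ : ∀ n, V (n + 1) → V n)
    (h : ∀ n w, b n (b (n + 1) w) = ρ n (ρ (n + 1) w)) {i j : ℕ} (hij : i ≤ j)
    (he : Even (j - i)) (w : V j) : descend b w i hij = descend ρ w i hij := by
  obtain ⟨k, rfl⟩ : ∃ k, j = i + 2 * k := by
    obtain ⟨k, hk⟩ := he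
    exact ⟨k, by omega⟩
  exact descend_add_two_mul b ρ h i k w

end Descend

/-- Two sequences can be merged into one with prescribed terms at even and at odd places. -/
theorem exists_even_odd {α : ℕ → Type*} (a : ∀ j, α (2 * j)) (b : ∀ j, α (2 * j + 1)) :
    ∃ f : ∀ n, α n, (∀ j, f (2 * j) = a j) ∧ ∀ j, f (2 * j + 1) = b j := by
  have key : ∀ n, ∃ e : α n, (∀ j (h : n = 2 * j), h ▸ e = a j) ∧
      ∀ j (h : n = 2 * j + 1), h ▸ e = b j := by
    intro n
    obtain ⟨k, rfl | rfl⟩ := n.even_or_odd'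
    · refine ⟨a k, fun j h => ?_, fun j h => by omega⟩
      obtain rfl : k = j := by omega
      rfl
    · refine ⟨b k, fun j h => by omega, fun j h => ?_⟩
      obtain rfl : k = j := by omega
      rfl
  choose f hf using key
  exact ⟨f, fun j => (hf _).1 j rfl, fun j => (hf _).2 j rfl⟩

/-! ### Colours with unique sources -/

namespace PreDiagram

variable (F : PreDiagram.{u})

/-- The blue edges of a layer. -/
def blue (n : ℕ) : Set (F.E n) := {e | e ∈ F.B (F.r e)}

/-- The red edges of a layer. -/
def red (n : ℕ) : Set (F.E n) := {e | e ∈ F.R (F.r e)}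

/-- A set of edges in which every vertex outside layer `0` is the source of exactly one edge. -/
def HasUniqueSources (K : ∀ n, Set (F.E n)) : Prop :=
  ∀ n (w : F.V (n + 1)), ∃! e, e ∈ K n ∧ F.s e = w

variable {F}

namespace HasUniqueSources

variable {K : ∀ n, Set (F.E n)} (h : F.HasUniqueSources K) {n : ℕ}
include h

/-- The edge of the colour with a given source. -/
noncomputable def edge (w : F.V (n + 1)) : F.E n := (h n w).choose

theorem edge_mem (w : F.V (n + 1)) : h.edge w ∈ K n := (h n w).choose_spec.1.1

theorem source_edge (w : F.V (n + 1)) : F.s (h.edge w) = w := (h n w).choose_spec.1.2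

theorem eq_edge {e : F.E n} (he : e ∈ K n) : e = h.edge (F.s e) :=
  (h n (F.s e)).choose_spec.2 e ⟨he, rfl⟩

theorem unique {e e' : F.E n} (he : e ∈ K n) (he' : e' ∈ K n) (hs : F.s e = F.s e') : e = e' := by
  rw [h.eq_edge he, h.eq_edge he', hs]

/-- The range of the edge of the colour with a given source. -/
noncomputable def par (n : ℕ) (w : F.V (n + 1)) : F.V n := F.r (h.edge w)

theorem par_source {e : F.E n} (he : e ∈ K n) : h.par n (F.s e) = F.r e := by
  rw [par, ← h.eq_edge he]

theorem par_eq {e : F.E n} {w : F.V (n + 1)} (he : e ∈ K n) (hs : F.s e = w) :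
    h.par n w = F.r e := by
  rw [← hs, h.par_source he]

/-- The path of the colour that descends from a given vertex. -/
noncomputable def path {j : ℕ} (w : F.V j) (i : ℕ) : F.Path i j where
  vert k _ hk := descend h.par w k hk
  edge k _ hk := h.edge (descend h.par w (k + 1) hk)
  range_eq _ _ hk := (descend_of_lt h.par w hk).symm
  source_eq _ _ _ := h.source_edge _

theorem descend_path {i j : ℕ} (p : F.Path i j) (hp : ∀ k hi hj, p.edge k hi hj ∈ K k)
    {k : ℕ} (hi : i ≤ k) (hj : k ≤ j) :
    descend h.par (p.vert j (hi.trans hj) le_rfl) k hj = p.vert k hi hj :=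
  descend_eq h.par p.vert (fun l hi hj => by
    rw [← p.source_eq l hi hj, h.par_source (hp l hi hj), p.range_eq]) hi hj le_rfl

/-- A path of the colour is determined by its last vertex. -/
theorem path_unique {i j : ℕ} (hij : i ≤ j) {p q : F.Path i j}
    (hp : ∀ k hi hj, p.edge k hi hj ∈ K k) (hq : ∀ k hi hj, q.edge k hi hj ∈ K k)
    (hv : p.vert j hij le_rfl = q.vert j hij le_rfl) : p = q := by
  have hvert : p.vert = q.vert := by
    funext k hi hj
    rw [← h.descend_path p hp hi hj, ← h.descend_path q hq hi hj, hv]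
  refine PreDiagram.Path.ext hvert ?_
  funext k hi hj
  exact h.unique (hp k hi hj) (hq k hi hj) (by rw [p.source_eq, q.source_eq, hvert])

end HasUniqueSources

end PreDiagram

/-! ### Blue and red edges of `l`-diagrams -/

namespace IsLDiagram

variable {F : PreDiagram.{u}} (h : IsLDiagram F)
include h

theorem range_blue {n : ℕ} {v : F.V n} {e : F.E n} (he : e ∈ F.B v) : F.r e = v := by
  have : e ∈ ⋃₀ F.D v := by
    obtain ⟨j, rfl | rfl⟩ := n.even_or_odd'
    · exact ⟨F.B v, by rw [h.sep_even]; simp, he⟩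
    · exact ⟨F.B v, by rw [h.sep_odd]; simp, he⟩
  rwa [h.sep_union] at this

theorem range_red {n : ℕ} {v : F.V n} {e : F.E n} (he : e ∈ F.R v) : F.r e = v := by
  have : e ∈ ⋃₀ F.D v := by
    obtain ⟨j, rfl | rfl⟩ := n.even_or_odd'
    · exact ⟨F.R v, by rw [h.sep_even]; simp, he⟩
    · rw [h.red_odd] at he
      obtain ⟨f, hf, hs, hg⟩ := he
      exact ⟨F.Rof f, by rw [h.sep_odd]; exact Or.inr ⟨f, hf, hs, rfl⟩, hg⟩
  rwa [h.sep_union] at this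

theorem mem_blue {n : ℕ} {v : F.V n} {e : F.E n} (he : e ∈ F.B v) : e ∈ F.blue n := by
  change e ∈ F.B (F.r e)
  rwa [h.range_blue he]

theorem mem_red {n : ℕ} {v : F.V n} {e : F.E n} (he : e ∈ F.R v) : e ∈ F.red n := by
  change e ∈ F.R (F.r e)
  rwa [h.range_red he]

theorem mem_blue_or_red {j : ℕ} (e : F.E (2 * j)) : e ∈ F.blue (2 * j) ∨ e ∈ F.red (2 * j) := by
  have : e ∈ ⋃₀ F.D (F.r e) := by rw [h.sep_union]; rfl
  rw [h.sep_even] at this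
  obtain ⟨A, rfl | rfl, he⟩ := this
  exacts [Or.inl he, Or.inr he]

theorem exists_red_odd {j : ℕ} (w : F.V (2 * j + 2)) : ∃ f ∈ F.red (2 * j + 1), F.s f = w := by
  have : w ∈ ⋃ v : F.V (2 * j + 1), F.s '' F.R v := by rw [(h.even_red j).1]; trivial
  obtain ⟨v, f, hf, hs⟩ := mem_iUnion.1 this
  exact ⟨f, h.mem_red hf, hs⟩

/-- Every vertex is the source of exactly one blue edge. -/
theorem hasUniqueSources_blue : F.HasUniqueSources F.blue := by
  intro n w
  refine existsUnique_of_exists_of_unique ?_ ?_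
  · obtain ⟨j, rfl | rfl⟩ := n.even_or_odd'
    · rcases j with _ | j
      · have : w ∈ ⋃ v : F.V 0, F.s '' F.B v := by rw [h.first_blue.1]; trivial
        obtain ⟨v, e, he, hs⟩ := mem_iUnion.1 this
        exact ⟨e, h.mem_blue he, hs⟩
      · -- If `w` is the source of a red edge `e`, there is a red edge `f` with source `r(e)`, and
        -- the blue side of the romb on `(f, e)` ends with a blue edge with source `w`.
        obtain ⟨e, rfl⟩ := h.source_surj _ w
        rcases h.mem_blue_or_red e with he | he
        · exact ⟨e, he, rfl⟩
        · obtain ⟨f, hf, hs⟩ := h.exists_red_odd (F.r e)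
          obtain ⟨⟨a, b⟩, ⟨-, hb, -, -, hsb⟩, -⟩ := h.romb_red j (F.r f) f e hf he rfl hs
          exact ⟨b, hb, hsb⟩
    · have : w ∈ ⋃ v : F.V (2 * j + 1), F.s '' F.B v := by rw [(h.even_blue j).1]; trivial
      obtain ⟨v, f, hf, hs⟩ := mem_iUnion.1 this
      exact ⟨f, h.mem_blue hf, hs⟩
  · rintro e e' ⟨he, hs⟩ ⟨he', hs'⟩
    obtain ⟨j, rfl | rfl⟩ := n.even_or_odd'
    · by_contra hne
      exact h.odd_blue_inj j _ _ e he e' he' hne (hs.trans hs'.symm)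
    · by_cases hvw : F.r e = F.r e'
      · refine h.even_blue_inj j (F.r e) he ?_ (hs.trans hs'.symm)
        rw [hvw]; exact he'
      · exact absurd ⟨e', he', hs'.trans hs.symm⟩
          (disjoint_left.1 ((h.even_blue j).2 hvw) ⟨e, he, rfl⟩)

/-- The range of the blue edge with a given source. -/
noncomputable abbrev par (n : ℕ) (w : F.V (n + 1)) : F.V n := h.hasUniqueSources_blue.par n w

theorem par_source {n : ℕ} {e : F.E n} (he : e ∈ F.blue n) : h.par n (F.s e) = F.r e :=
  h.hasUniqueSources_blue.par_source he

theorem mem_Rof {j : ℕ} {f : F.E (2 * j)} {g : F.E (2 * j + 1)} (hf : f ∈ F.red (2 * j))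
    (hg : g ∈ F.Rof f) : g ∈ F.red (2 * j + 1) ∧ F.r g = F.s f := by
  have : g ∈ F.R (F.s f) := by
    rw [h.red_odd]
    exact ⟨f, hf, rfl, hg⟩
  exact ⟨h.mem_red this, h.range_red this⟩

theorem exists_mem_Rof {j : ℕ} {g : F.E (2 * j + 1)} (hg : g ∈ F.red (2 * j + 1)) :
    ∃ f ∈ F.red (2 * j), F.s f = F.r g ∧ g ∈ F.Rof f := by
  have : g ∈ F.R (F.r g) := hg
  rw [h.red_odd] at this
  exact this

/-- The red side of a romb at an even layer has the same ends as the blue side. -/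
theorem par_par_of_mem_Rof {j : ℕ} {f : F.E (2 * j)} {g : F.E (2 * j + 1)}
    (hf : f ∈ F.red (2 * j)) (hg : g ∈ F.Rof f) :
    h.par (2 * j) (h.par (2 * j + 1) (F.s g)) = F.r f := by
  obtain ⟨S, hB, hR⟩ := h.compat j (F.r f)
  have hS : F.s g ∈ S := by
    rw [← hR.1]
    exact mem_iUnion.2 ⟨⟨f, hf⟩, g, hg, rfl⟩
  rw [← hB.1] at hS
  obtain ⟨⟨a, ha⟩, b, hb, hs⟩ := mem_iUnion.1 hS
  rw [← hs, h.par_source (h.mem_blue hb), h.range_blue hb, h.par_source (h.mem_blue ha),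
    h.range_blue ha]

/-- The red side of a romb at an odd layer has the same ends as the blue side. -/
theorem par_par_of_red {j : ℕ} {f : F.E (2 * j + 1)} {g : F.E (2 * j + 2)}
    (hf : f ∈ F.red (2 * j + 1)) (hg : g ∈ F.red (2 * j + 2)) (hfg : F.s f = F.r g) :
    h.par (2 * j + 1) (h.par (2 * j + 2) (F.s g)) = F.r f := by
  obtain ⟨⟨a, b⟩, ⟨ha, hb, hra, hab, hs⟩, -⟩ := h.romb_red j (F.r f) f g hf hg rfl hfg
  dsimp only at ha hb hra hab hs
  rw [← hs, h.par_source hb, ← hab, h.par_source ha, hra]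

end IsLDiagram

/-! ### The space of infinite blue paths -/

namespace PreDiagram

variable {F : PreDiagram.{u}}

/-- The `n`-th vertex of an infinite blue path. -/
def PathSpace.vtx (x : F.PathSpace) (n : ℕ) : F.V n := F.r (x.1 n)

theorem PathSpace.source (x : F.PathSpace) (n : ℕ) : F.s (x.1 n) = x.vtx (n + 1) :=
  (x.2 n).2.symm

theorem PathSpace.mem_blue (x : F.PathSpace) (n : ℕ) : x.1 n ∈ F.blue n := (x.2 n).1

theorem isOpen_cylinder (x : F.PathSpace) (n : ℕ) : IsOpen (F.cylinder x n) :=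
  TopologicalSpace.isOpen_generateFrom_of_mem ⟨x, n, rfl⟩

theorem isOpen_setOf_vtx (n : ℕ) (v : F.V n) : IsOpen {x : F.PathSpace | x.vtx n = v} := by
  refine isOpen_iff_forall_mem_open.2 fun x hx => ⟨F.cylinder x n, fun y hy => ?_,
    isOpen_cylinder x n, fun _ _ => rfl⟩
  have : y.1 n = x.1 n := hy n le_rfl
  change F.r (y.1 n) = v
  rw [this]
  exact hx

/-- A red edge runs from `w` to `v`. -/
def RedStep (F : PreDiagram.{u}) {n : ℕ} (w : F.V (n + 1)) (v : F.V n) : Prop :=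
  ∃ e ∈ F.red n, F.s e = w ∧ F.r e = v

end PreDiagram

open PreDiagram

namespace IsLDiagram

variable {F : PreDiagram.{u}} (h : IsLDiagram F)
include h

theorem par_vtx (x : F.PathSpace) (n : ℕ) : h.par n (x.vtx (n + 1)) = x.vtx n :=
  (congrArg (h.par n) (x.source n)).symm.trans (h.par_source (x.mem_blue n))

theorem vtx_eq_of_le {x y : F.PathSpace} {n k : ℕ} (hk : k ≤ n) (hn : x.vtx n = y.vtx n) :
    x.vtx k = y.vtx k := by
  rw [← descend_seq h.par x.vtx (h.par_vtx x) hk, hn, descend_seq h.par y.vtx (h.par_vtx y) hk]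

theorem edge_eq_of_vtx_eq {x y : F.PathSpace} {n : ℕ} (hn : x.vtx (n + 1) = y.vtx (n + 1)) :
    x.1 n = y.1 n :=
  h.hasUniqueSources_blue.unique (x.mem_blue n) (y.mem_blue n) (by rw [x.source, y.source, hn])

/-- An infinite blue path is determined by infinitely many of its vertices. -/
theorem pathSpace_ext {x y : F.PathSpace} (hxy : ∀ n, ∃ k ≥ n, x.vtx k = y.vtx k) : x = y := by
  refine Subtype.ext (funext fun n => ?_)
  obtain ⟨k, hk, e⟩ := hxy (n + 1)
  exact h.edge_eq_of_vtx_eq (h.vtx_eq_of_le hk e)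

theorem cylinder_eq (x : F.PathSpace) (n : ℕ) :
    F.cylinder x n = {y | y.vtx (n + 1) = x.vtx (n + 1)} := by
  ext y
  constructor
  · intro hy
    change y.vtx (n + 1) = x.vtx (n + 1)
    rw [← x.source, ← y.source, hy n le_rfl]
  · intro hy i hi
    exact h.edge_eq_of_vtx_eq (h.vtx_eq_of_le (Nat.succ_le_succ hi) hy)

theorem continuous_of_vtx {Y : Type*} [TopologicalSpace Y] {f : Y → F.PathSpace}
    (hf : ∀ n v, IsOpen {y | (f y).vtx n = v}) : Continuous f := by
  refine continuous_generateFrom_iff.2 ?_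
  rintro _ ⟨x, n, rfl⟩
  rw [h.cylinder_eq]
  exact hf (n + 1) _

/-- The infinite blue path with a given compatible sequence of vertices. -/
noncomputable def ofVerts (v : ∀ n, F.V n) (hv : ∀ n, h.par n (v (n + 1)) = v n) : F.PathSpace :=
  ⟨fun n => h.hasUniqueSources_blue.edge (v (n + 1)), fun n =>
    ⟨h.hasUniqueSources_blue.edge_mem _, (hv (n + 1)).trans
      (h.hasUniqueSources_blue.source_edge _).symm⟩⟩

theorem vtx_ofVerts (v : ∀ n, F.V n) (hv : ∀ n, h.par n (v (n + 1)) = v n) (n : ℕ) :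
    (h.ofVerts v hv).vtx n = v n := hv n

/-! ### The map on infinite blue paths -/

/-- At the odd layers, red edges are compatible with passing to the blue parents twice. -/
theorem redStep_par_par {j : ℕ} {w : F.V (2 * j + 4)} {u : F.V (2 * j + 3)}
    (hwu : F.RedStep (n := 2 * (j + 1) + 1) w u) :
    F.RedStep (n := 2 * j + 1) (h.par (2 * j + 2) (h.par (2 * j + 3) w))
      (h.par (2 * j + 1) (h.par (2 * j + 2) u)) := by
  obtain ⟨g, hg, rfl, rfl⟩ := hwu
  obtain ⟨f, hf, hs, hgf⟩ := h.exists_mem_Rof hg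
  have h₁ := h.par_par_of_mem_Rof hf hgf
  obtain ⟨k, hk, hks⟩ := h.exists_red_odd (j := j) (F.r f)
  have h₂ := h.par_par_of_red hk hf hks
  refine ⟨k, hk, hks.trans h₁.symm, h₂.symm.trans ?_⟩
  rw [hs]

/-- The map on infinite blue paths is read off from the red edges in the odd layers. -/
theorem mapsTo_iff {x y : F.PathSpace} :
    F.MapsTo x y ↔ ∀ j, F.RedStep (x.vtx (2 * j + 2)) (y.vtx (2 * j + 1)) := by
  constructor
  · rintro ⟨f, hf, h₁, h₂⟩ j
    exact ⟨f (2 * j + 1), hf _, (h₁ j).2.2.1.trans (x.source _), (h₂ j).1.symm⟩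
  · intro H
    choose g hg hgs hgr using H
    choose e he hes heg using fun j => h.exists_mem_Rof (hg j)
    obtain ⟨f, hfe, hfg⟩ := exists_even_odd (α := F.E) e g
    have her : ∀ j, F.r (e j) = x.vtx (2 * j) := fun j => by
      rw [← h.par_par_of_mem_Rof (he j) (heg j), hgs, h.par_vtx, h.par_vtx]
    refine ⟨f, fun n => ?_, fun j => ⟨?_, ?_, ?_, ?_⟩, fun j => ⟨?_, ?_, ?_⟩⟩
    · obtain ⟨j, rfl | rfl⟩ := n.even_or_odd'
      · rw [hfe]; exact he j
      · rw [hfg]; exact hg j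
    · rw [hfe]; exact her j
    · rw [hfe, hfg]; exact hes j
    · rw [hfg, hgs, x.source]
    · rw [hfe, hfg]; exact heg j
    · rw [hfg]; exact (hgr j).symm
    · have := hfe (j + 1)
      change f (2 * j + 2) = _ at this
      rw [hfg, this, hgs]; exact (her (j + 1)).symm
    · have := hfe (j + 1)
      change f (2 * j + 2) = _ at this
      rw [this, y.source]
      exact ((hes (j + 1)).trans (hgr (j + 1))).symm

/-- It suffices to compare two infinite blue paths at infinitely many layers. -/
theorem mapsTo_of_frequently {x y : F.PathSpace}
    (H : ∀ j, ∃ k ≥ j, F.RedStep (x.vtx (2 * k + 2)) (y.vtx (2 * k + 1))) : F.MapsTo x y := by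
  refine h.mapsTo_iff.2 fun j => ?_
  obtain ⟨k, hk, hr⟩ := H j
  induction k, hk using Nat.le_induction with
  | base => exact hr
  | succ k hk ih =>
    refine ih ?_
    have hx := (congrArg _ (h.par_vtx x (2 * k + 3))).trans (h.par_vtx x (2 * k + 2))
    have hy := (congrArg _ (h.par_vtx y (2 * k + 2))).trans (h.par_vtx y (2 * k + 1))
    exact hx ▸ hy ▸ h.redStep_par_par (j := k) hr

end IsLDiagram

/-! ### Invariance of the path system under isomorphism and contraction -/

/-- The systems of infinite blue paths of two diagrams are isomorphic. The maps enter
through their graphs `MapsTo`, which make sense for every diagram, so that no map has to be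
constructed for `l`-diagrams. -/
def PreDiagram.PathConj (F G : PreDiagram.{u}) : Prop :=
  ∃ T : F.PathSpace ≃ₜ G.PathSpace, ∀ x y, F.MapsTo x y ↔ G.MapsTo (T x) (T y)

theorem PreDiagram.PathConj.refl (F : PreDiagram.{u}) : F.PathConj F :=
  ⟨Homeomorph.refl _, fun _ _ => Iff.rfl⟩

theorem PreDiagram.PathConj.symm {F G : PreDiagram.{u}} (h : F.PathConj G) : G.PathConj F := by
  obtain ⟨T, hT⟩ := h
  exact ⟨T.symm, fun x y => by simp [hT]⟩

theorem PreDiagram.PathConj.trans {F G H : PreDiagram.{u}} (h : F.PathConj G)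
    (h' : G.PathConj H) : F.PathConj H := by
  obtain ⟨T, hT⟩ := h
  obtain ⟨U, hU⟩ := h'
  exact ⟨T.trans U, fun x y => by simp [hT, hU]⟩

theorem IsLDiagram.continuous_of_factor {F G : PreDiagram.{u}} (hG : IsLDiagram G)
    {f : F.PathSpace → G.PathSpace}
    (H : ∀ n, ∃ k, ∃ g : F.V k → G.V n, ∀ x, (f x).vtx n = g (x.vtx k)) : Continuous f := by
  refine hG.continuous_of_vtx fun n v => ?_
  obtain ⟨k, g, hg⟩ := H n
  have : {x | (f x).vtx n = v} = ⋃ w ∈ g ⁻¹' {v}, {x : F.PathSpace | x.vtx k = w} := by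
    ext x
    simp [hg]
  rw [this]
  exact isOpen_biUnion fun w _ => isOpen_setOf_vtx k w

/-! ### Isomorphism -/

section Iso

variable {F G : PreDiagram.{u}} (φ : F.Iso G)
include φ

theorem PreDiagram.Iso.par_vert (hF : IsLDiagram F) (hG : IsLDiagram G) (n : ℕ)
    (w : F.V (n + 1)) : hG.par n (φ.vert (n + 1) w) = φ.vert n (hF.par n w) := by
  have he := hF.hasUniqueSources_blue.edge_mem w
  have hs := hF.hasUniqueSources_blue.source_edge w
  have hmem : φ.edge n (hF.hasUniqueSources_blue.edge w) ∈ G.blue n := by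
    change _ ∈ G.B _
    rw [φ.map_r, ← φ.map_B]
    exact mem_image_of_mem _ he
  exact (hG.hasUniqueSources_blue.par_eq hmem (by rw [φ.map_s, hs])).trans (φ.map_r ..)

theorem PreDiagram.Iso.mem_red_even {j : ℕ} (f : F.E (2 * j)) :
    φ.edge (2 * j) f ∈ G.red (2 * j) ↔ f ∈ F.red (2 * j) := by
  change _ ∈ G.R _ ↔ f ∈ F.R _
  rw [φ.map_r, ← φ.map_R]
  exact (φ.edge (2 * j)).injective.mem_set_image

theorem PreDiagram.Iso.mem_red_odd (hF : IsLDiagram F) (hG : IsLDiagram G) {j : ℕ}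
    (g : F.E (2 * j + 1)) :
    φ.edge (2 * j + 1) g ∈ G.red (2 * j + 1) ↔ g ∈ F.red (2 * j + 1) := by
  constructor
  · intro hg
    obtain ⟨f, hf, -, hgf⟩ := hG.exists_mem_Rof hg
    obtain ⟨f, rfl⟩ := (φ.edge (2 * j)).surjective f
    rw [φ.mem_red_even] at hf
    rw [← φ.map_Rof j f hf] at hgf
    exact (hF.mem_Rof hf ((φ.edge (2 * j + 1)).injective.mem_set_image.1 hgf)).1
  · intro hg
    obtain ⟨f, hf, -, hgf⟩ := hF.exists_mem_Rof hg
    refine (hG.mem_Rof ((φ.mem_red_even f).2 hf) ?_).1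
    rw [← φ.map_Rof j f hf]
    exact mem_image_of_mem _ hgf

theorem PreDiagram.Iso.redStep_vert (hF : IsLDiagram F) (hG : IsLDiagram G) {j : ℕ}
    (w : F.V (2 * j + 2)) (v : F.V (2 * j + 1)) :
    G.RedStep (φ.vert (2 * j + 2) w) (φ.vert (2 * j + 1) v) ↔ F.RedStep w v := by
  constructor
  · rintro ⟨e, he, hs, hr⟩
    obtain ⟨e, rfl⟩ := (φ.edge (2 * j + 1)).surjective e
    rw [φ.map_s] at hs
    rw [φ.map_r] at hr
    exact ⟨e, (φ.mem_red_odd hF hG e).1 he, (φ.vert _).injective hs, (φ.vert _).injective hr⟩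
  · rintro ⟨e, he, rfl, rfl⟩
    exact ⟨_, (φ.mem_red_odd hF hG e).2 he, φ.map_s .., φ.map_r ..⟩

theorem PreDiagram.Iso.pathConj (hF : IsLDiagram F) (hG : IsLDiagram G) : F.PathConj G := by
  let T : F.PathSpace → G.PathSpace := fun x => hG.ofVerts (fun n => φ.vert n (x.vtx n))
    fun n => by rw [φ.par_vert hF hG, hF.par_vtx]
  let U : G.PathSpace → F.PathSpace := fun y => hF.ofVerts (fun n => (φ.vert n).symm (y.vtx n))
    fun n => by rw [Equiv.eq_symm_apply, ← φ.par_vert hF hG, Equiv.apply_symm_apply, hG.par_vtx]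
  have hT : ∀ x n, (T x).vtx n = φ.vert n (x.vtx n) := fun x n => hG.vtx_ofVerts ..
  have hU : ∀ y n, (U y).vtx n = (φ.vert n).symm (y.vtx n) := fun y n => hF.vtx_ofVerts ..
  refine ⟨⟨⟨T, U, fun x => ?_, fun y => ?_⟩, ?_, ?_⟩, fun x y => ?_⟩
  · exact hF.pathSpace_ext fun n => ⟨n, le_rfl, by rw [hU, hT, Equiv.symm_apply_apply]⟩
  · exact hG.pathSpace_ext fun n => ⟨n, le_rfl, by rw [hT, hU, Equiv.apply_symm_apply]⟩
  · exact hG.continuous_of_factor fun n => ⟨n, _, fun x => hT x n⟩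
  · exact hF.continuous_of_factor fun n => ⟨n, _, fun y => hU y n⟩
  · rw [hF.mapsTo_iff, hG.mapsTo_iff]
    refine forall_congr' fun j => ?_
    change _ ↔ G.RedStep ((T x).vtx (2 * j + 2)) ((T y).vtx (2 * j + 1))
    rw [hT, hT, φ.redStep_vert hF hG]

end Iso

/-! ### Contraction -/

theorem ContractionSeq.mod_two (m : ContractionSeq) (n : ℕ) : m.m n % 2 = n % 2 := by
  induction n with
  | zero => exact Nat.even_iff.1 m.even_zero
  | succ n ih =>
    have h₁ := m.odd_gap n
    have h₂ := m.lt n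
    unfold Nat.ModEq at h₁
    omega

theorem ContractionSeq.le (m : ContractionSeq) (n : ℕ) : n ≤ m.m n := m.strictMono.le_apply

section Contract

variable {F : PreDiagram.{u}} (hF : IsLDiagram F)
include hF

theorem IsLDiagram.par_contract {m : ContractionSeq} (hG : IsLDiagram (F.contract m)) (n : ℕ)
    (w : F.V (m.m (n + 1))) :
    hG.par n w = descend hF.par w (m.m n) (m.lt n).le := by
  have hB := hF.hasUniqueSources_blue
  let e : (F.contract m).E n := Sum.inl ⟨hB.path w (m.m n), fun _ _ _ => hB.edge_mem _⟩
  have he : e ∈ (F.contract m).blue n := ⟨rfl, rfl⟩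
  exact hG.hasUniqueSources_blue.par_eq he (descend_self hF.par w)

/-- The even vertices of a red path lie on a blue path. -/
theorem IsLDiagram.descend_red_path {a l : ℕ} {p : F.Path a l} (hp : p.IsRed) (k : ℕ) :
    ∀ i (ha : a ≤ i) (hl : i ≤ l), Even i → i + 2 * k = l →
      descend hF.par (p.vert l (ha.trans hl) le_rfl) i hl = p.vert i ha hl := by
  induction k with
  | zero =>
    intro i ha hl _ h
    obtain rfl : i = l := by omega
    exact descend_self ..
  | succ k ih =>
    intro i ha hl hi h
    have h₂ := ih (i + 2) (by omega) (by omega) (hi.add even_two) (by omega)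
    obtain ⟨j, rfl⟩ := hi.two_dvd
    have hlt : 2 * j + 1 < l := by omega
    have h₃ := hF.par_par_of_mem_Rof (hp.1 (2 * j) ha (by omega)) (hp.2 (2 * j) ha hlt hi)
    rw [p.source_eq, p.range_eq] at h₃
    have h₄ : _ = p.vert (2 * j + 1 + 1) _ hlt := h₂
    rw [← h₃, ← h₄]
    exact (descend_of_lt hF.par _ hlt.le).trans (congrArg _ (descend_of_lt hF.par _ hlt))

theorem IsLDiagram.pathConj_contract {m : ContractionSeq} (hG : IsLDiagram (F.contract m)) :
    F.PathConj (F.contract m) := by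
  let T : F.PathSpace → (F.contract m).PathSpace := fun x =>
    hG.ofVerts (fun n => x.vtx (m.m n)) fun n => by
      rw [hF.par_contract hG, descend_seq hF.par x.vtx (hF.par_vtx x)]
  have hT : ∀ x n, (T x).vtx n = x.vtx (m.m n) := fun x n => hG.vtx_ofVerts ..
  let U : (F.contract m).PathSpace → F.PathSpace := fun y =>
    hF.ofVerts (fun i => descend hF.par (V := F.V) (y.vtx i) i (m.le i)) fun i => by
      have h₁ := hF.par_contract hG i (y.vtx (i + 1))
      rw [hG.par_vtx] at h₁
      refine (descend_of_lt hF.par (V := F.V) (y.vtx (i + 1)) (m.le (i + 1))).symm.trans ?_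
      rw [h₁]
      exact (descend_descend hF.par _ _ _).symm
  have hU : ∀ y i, (U y).vtx i = descend hF.par (V := F.V) (y.vtx i) i (m.le i) :=
    fun y i => hF.vtx_ofVerts ..
  have hTU : ∀ y, T (U y) = y := fun y => hG.pathSpace_ext fun n => ⟨n, le_rfl, by
    rw [hT, hU]
    have key : ∀ k (h : n ≤ k),
        descend hF.par (V := F.V) (y.vtx k) (m.m n) (m.strictMono.monotone h) = y.vtx n := by
      intro k h
      induction k, h using Nat.le_induction with
      | base => exact descend_self ..
      | succ k h ih =>
        have h₁ := hF.par_contract hG k (y.vtx (k + 1))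
        rw [hG.par_vtx] at h₁
        rw [h₁] at ih
        rw [← ih]
        exact (descend_descend hF.par _ _ _).symm
    exact key _ (m.le n)⟩
  refine ⟨⟨⟨T, U, fun x => ?_, hTU⟩, ?_, ?_⟩, fun x y => ?_⟩
  · exact hF.pathSpace_ext fun n => ⟨n, le_rfl, by
      rw [hU, hT, descend_seq hF.par x.vtx (hF.par_vtx x)]⟩
  · exact hG.continuous_of_factor fun n => ⟨m.m n, id, fun x => hT x n⟩
  · exact hF.continuous_of_factor fun n => ⟨n, _, fun y => hU y n⟩
  · change _ ↔ (F.contract m).MapsTo (T x) (T y)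
    constructor
    · rintro ⟨f, hf, h₁, h₂⟩
      refine hG.mapsTo_iff.2 fun j => ?_
      rw [hT, hT]
      have hrs : ∀ n, F.s (f n) = F.r (f (n + 1)) := by
        intro n
        obtain ⟨i, rfl | rfl⟩ := n.even_or_odd'
        exacts [(h₁ i).2.1, (h₂ i).2.1]
      refine ⟨Sum.inr ⟨⟨fun i _ _ => F.r (f i), fun i _ _ => f i, fun _ _ _ => rfl,
        fun i _ _ => hrs i⟩, fun i _ _ => hf i, fun i _ _ hi => ?_⟩, ⟨rfl, rfl⟩, ?_, ?_⟩
      · obtain ⟨i, rfl⟩ := hi.two_dvd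
        exact (h₁ i).2.2.2
      · have := m.mod_two (2 * j + 1 + 1)
        change F.r (f (m.m (2 * j + 1 + 1))) = x.vtx (m.m (2 * j + 1 + 1))
        obtain ⟨i, hi⟩ : ∃ i, m.m (2 * j + 1 + 1) = 2 * i := ⟨m.m (2 * j + 1 + 1) / 2, by omega⟩
        rw [hi]
        exact (h₁ i).1
      · have := m.mod_two (2 * j + 1)
        change F.r (f (m.m (2 * j + 1))) = y.vtx (m.m (2 * j + 1))
        obtain ⟨i, hi⟩ : ∃ i, m.m (2 * j + 1) = 2 * i + 1 := ⟨m.m (2 * j + 1) / 2, by omega⟩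
        rw [hi]
        exact (h₂ i).1.symm
    · intro H
      -- The first edge of the contracted red step already lies in an odd layer of `F`.
      refine hF.mapsTo_of_frequently fun j => ?_
      obtain ⟨e, he, hs, hr⟩ := hG.mapsTo_iff.1 H j
      rw [hT] at hs hr
      obtain p | p := e
      · exact absurd he.1 (by simp)
      have hle := m.le (2 * j + 1)
      have hlt := m.lt (2 * j + 1)
      have hm₁ := m.mod_two (2 * j + 1)
      have hm₂ := m.mod_two (2 * j + 1 + 1)
      have hd := hF.descend_red_path p.2 ((m.m (2 * j + 1 + 1) - m.m (2 * j + 1) - 1) / 2)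
        (m.m (2 * j + 1) + 1) (by omega) hlt (by rw [Nat.even_iff]; omega) (by omega)
      have hs' : p.1.vert (m.m (2 * j + 1 + 1)) hlt.le le_rfl = x.vtx (m.m (2 * j + 1 + 1)) := hs
      rw [hs', descend_seq hF.par x.vtx (hF.par_vtx x)] at hd
      have key : F.RedStep (x.vtx (m.m (2 * j + 1) + 1)) (y.vtx (m.m (2 * j + 1))) :=
        ⟨p.1.edge _ le_rfl hlt, p.2.1 _ _ _, (p.1.source_eq ..).trans hd.symm,
          (p.1.range_eq ..).trans hr⟩
      obtain ⟨i, hi⟩ : ∃ i, m.m (2 * j + 1) = 2 * i + 1 := ⟨m.m (2 * j + 1) / 2, by omega⟩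
      rw [hi] at key
      exact ⟨i, by omega, key⟩

end Contract

/-- Equivalent `l`-diagrams have isomorphic systems of infinite blue paths. -/
theorem LDiag.pathConj {F G : LDiag.{u}} (h : F ≈ G) : F.1.PathConj G.1 := by
  change Relation.EqvGen _ F G at h
  induction h with
  | rel F G h =>
    obtain ⟨⟨φ⟩⟩ | ⟨m, hm⟩ := h
    · exact φ.pathConj F.2 G.2
    · have hG := G.2
      rw [hm] at hG ⊢
      exact F.2.pathConj_contract hG
  | refl F => exact .refl _
  | symm F G _ ih => exact ih.symm
  | trans F G H _ _ ih₁ ih₂ => exact ih₁.trans ih₂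

/-! ### `h`-diagrams as towers with two families of maps -/

section Colour

variable {F : PreDiagram.{u}} {C : ∀ n, F.V n → Set (F.E n)}
  (hC : F.HasUniqueSources fun n => {e | e ∈ C n (F.r e)})
  (hr : ∀ n (v : F.V n), ∀ e ∈ C n v, F.r e = v)
include hC hr

theorem par_eq_iff {n : ℕ} {w : F.V (n + 1)} {v : F.V n} :
    hC.par n w = v ↔ ∃ e ∈ C n v, F.s e = w := by
  constructor
  · rintro rfl
    exact ⟨hC.edge w, hC.edge_mem w, hC.source_edge w⟩
  · rintro ⟨e, he, hs⟩
    have := hr n v e he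
    rw [hC.par_eq (e := e) (by change e ∈ C n (F.r e); rwa [this]) hs, this]

theorem isDisjointUnion_source_image (n : ℕ) :
    IsDisjointUnion (fun v : F.V n => F.s '' C n v) univ := by
  refine ⟨eq_univ_of_forall fun w => mem_iUnion.2 ⟨hC.par n w, ?_⟩, fun v v' hne => ?_⟩
  · exact (par_eq_iff hC hr).1 rfl
  · exact disjoint_left.2 fun w hw hw' =>
      hne (((par_eq_iff hC hr).2 hw).symm.trans ((par_eq_iff hC hr).2 hw'))

theorem injOn_source (n : ℕ) (v : F.V n) : InjOn F.s (C n v) := by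
  intro e he e' he' hs
  have h₁ := hr n v e he
  have h₂ := hr n v e' he'
  exact hC.unique (by change e ∈ C n (F.r e); rwa [h₁]) (by change e' ∈ C n (F.r e'); rwa [h₂]) hs

theorem isDisjointUnion_two_steps (n : ℕ) (v : F.V n) :
    IsDisjointUnion (fun e : C n v => F.s '' C (n + 1) (F.s e.1))
      {w | hC.par n (hC.par (n + 1) w) = v} := by
  refine ⟨?_, fun e e' hne => ?_⟩
  · ext w
    simp only [mem_iUnion, mem_image, Subtype.exists, exists_prop]
    constructor
    · rintro ⟨e, he, g, hg, rfl⟩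
      change hC.par n (hC.par (n + 1) (F.s g)) = v
      rw [(par_eq_iff hC hr).2 ⟨g, hg, rfl⟩, (par_eq_iff hC hr).2 ⟨e, he, rfl⟩]
    · intro hw
      obtain ⟨e, he, hs⟩ := (par_eq_iff hC hr).1 (show hC.par n (hC.par (n + 1) w) = v from hw)
      exact ⟨e, he, (par_eq_iff hC hr).1 hs.symm⟩
  · refine disjoint_left.2 fun w hw hw' => hne (Subtype.ext (injOn_source hC hr n v e.2 e'.2 ?_))
    exact ((par_eq_iff hC hr).2 hw).symm.trans ((par_eq_iff hC hr).2 hw')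

end Colour

/-- A diagram with two colours in which every vertex is the source of exactly one edge of each
colour is an `h`-diagram as soon as the two families of parent maps `b`, `ρ` are surjective and
satisfy `b ∘ b = ρ ∘ ρ`. -/
theorem isHDiagram_of {F : PreDiagram.{u}} (finite_V : ∀ n, Finite (F.V n))
    (nonempty_V : ∀ n, Nonempty (F.V n)) (hB : F.HasUniqueSources F.blue)
    (hR : F.HasUniqueSources F.red) (rB : ∀ n (v : F.V n), ∀ e ∈ F.B v, F.r e = v)
    (rR : ∀ n (v : F.V n), ∀ e ∈ F.R v, F.r e = v) (nB : ∀ n (v : F.V n), (F.B v).Nonempty)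
    (nR : ∀ n (v : F.V n), (F.R v).Nonempty) (cover : ∀ n e, e ∈ F.blue n ∨ e ∈ F.red n)
    (disj : ∀ n (v : F.V n), Disjoint (F.B v) (F.R v))
    (compat : ∀ n w, hB.par n (hB.par (n + 1) w) = hR.par n (hR.par (n + 1) w))
    (sep : ∀ n (v : F.V n), F.D v = {F.B v, F.R v})
    (label : ∀ j (f : F.E (2 * j)), f ∈ F.R (F.r f) → F.Rof f = F.R (F.s f)) :
    IsHDiagram F where
  finite_V := finite_V
  finite_E n := by
    have := finite_V (n + 1)
    refine Finite.of_surjective (Sum.elim hB.edge hR.edge : F.V (n + 1) ⊕ F.V (n + 1) → F.E n) ?_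
    intro e
    rcases cover n e with h | h
    · exact ⟨Sum.inl (F.s e), (hB.eq_edge h).symm⟩
    · exact ⟨Sum.inr (F.s e), (hR.eq_edge h).symm⟩
  nonempty_V := nonempty_V
  nonempty_E n := (nonempty_V (n + 1)).map hB.edge
  range_surj n v := (nB n v).imp fun e he => rB n v e he
  source_surj n w := ⟨hB.edge w, hB.source_edge w⟩
  sep_nonempty n v A hA := by
    rw [sep] at hA
    rcases hA with rfl | rfl
    exacts [nB n v, nR n v]
  sep_disjoint n v := by
    rw [sep, pairwiseDisjoint_insert]
    refine ⟨pairwiseDisjoint_singleton .., ?_⟩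
    rintro _ rfl -
    exact disj n v
  sep_union n v := by
    rw [sep, sUnion_pair]
    ext e
    constructor
    · rintro (he | he)
      exacts [rB n v e he, rR n v e he]
    · rintro rfl
      exact cover n e
  sep := sep
  blue_red := disj
  vert_blue n := isDisjointUnion_source_image (C := fun _ v => F.B v) hB rB n
  vert_red n := isDisjointUnion_source_image (C := fun _ v => F.R v) hR rR n
  blue_inj n v := injOn_source (C := fun _ v => F.B v) hB rB n v
  red_inj n v := injOn_source (C := fun _ v => F.R v) hR rR n v
  compat n v := by
    refine ⟨_, isDisjointUnion_two_steps (C := fun _ v => F.B v) hB rB n v, ?_⟩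
    convert isDisjointUnion_two_steps (C := fun _ v => F.R v) hR rR n v using 3
    exact Eq.congr_left (compat n _)
  label := label

namespace IsHDiagram

variable {F G : PreDiagram.{u}} (h : IsHDiagram F)
include h

theorem hasUniqueSources_blue : F.HasUniqueSources F.blue := h.isLDiagram.hasUniqueSources_blue

theorem hasUniqueSources_red : F.HasUniqueSources F.red := by
  intro n w
  obtain ⟨f, hf, hs⟩ := h.exists_red w
  exact ⟨f, ⟨hf, hs⟩, fun g hg => h.red_unique hg.1 hf (hg.2.trans hs.symm)⟩

/-- The range of the blue edge with a given source. -/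
noncomputable abbrev bluePar (n : ℕ) (w : F.V (n + 1)) : F.V n := h.hasUniqueSources_blue.par n w

/-- The range of the red edge with a given source. -/
noncomputable abbrev redPar (n : ℕ) (w : F.V (n + 1)) : F.V n := h.hasUniqueSources_red.par n w

theorem bluePar_eq_iff {n : ℕ} {w : F.V (n + 1)} {v : F.V n} :
    h.bluePar n w = v ↔ ∃ e ∈ F.B v, F.s e = w :=
  par_eq_iff (C := fun _ v => F.B v) h.hasUniqueSources_blue fun _ _ _ => h.range_blue

theorem redPar_eq_iff {n : ℕ} {w : F.V (n + 1)} {v : F.V n} :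
    h.redPar n w = v ↔ ∃ e ∈ F.R v, F.s e = w :=
  par_eq_iff (C := fun _ v => F.R v) h.hasUniqueSources_red fun _ _ _ => h.range_red

theorem redStep_iff {n : ℕ} {w : F.V (n + 1)} {v : F.V n} : F.RedStep w v ↔ h.redPar n w = v := by
  constructor
  · rintro ⟨e, he, rfl, rfl⟩
    exact h.hasUniqueSources_red.par_source he
  · rintro rfl
    exact ⟨_, h.hasUniqueSources_red.edge_mem w, h.hasUniqueSources_red.source_edge w, rfl⟩

theorem blue_or_red {n : ℕ} (e : F.E n) : e ∈ F.blue n ∨ e ∈ F.red n := by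
  have : e ∈ ⋃₀ F.D (F.r e) := by rw [h.sep_union]; rfl
  rw [h.sep] at this
  obtain ⟨A, rfl | rfl, he⟩ := this
  exacts [Or.inl he, Or.inr he]

theorem bluePar_surjective (n : ℕ) : Function.Surjective (h.bluePar n) := by
  intro v
  obtain ⟨e, he⟩ := h.sep_nonempty n v (F.B v) (by rw [h.sep]; simp)
  exact ⟨F.s e, h.bluePar_eq_iff.2 ⟨e, he, rfl⟩⟩

theorem redPar_surjective (n : ℕ) : Function.Surjective (h.redPar n) := by
  intro v
  obtain ⟨e, he⟩ := h.sep_nonempty n v (F.R v) (by rw [h.sep]; simp)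
  exact ⟨F.s e, h.redPar_eq_iff.2 ⟨e, he, rfl⟩⟩

theorem bluePar_bluePar (n : ℕ) (w : F.V (n + 2)) :
    h.bluePar n (h.bluePar (n + 1) w) = h.redPar n (h.redPar (n + 1) w) := by
  obtain ⟨S, hB, hR⟩ := h.compat n (h.bluePar n (h.bluePar (n + 1) w))
  have hB' := isDisjointUnion_two_steps (C := fun _ v => F.B v) h.hasUniqueSources_blue
    (fun _ _ _ => h.range_blue) n (h.bluePar n (h.bluePar (n + 1) w))
  have hR' := isDisjointUnion_two_steps (C := fun _ v => F.R v) h.hasUniqueSources_red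
    (fun _ _ _ => h.range_red) n (h.bluePar n (h.bluePar (n + 1) w))
  have hw : w ∈ S := by
    rw [← hB.1, hB'.1]
    rfl
  rw [← hR.1, hR'.1] at hw
  exact hw.symm

/-! ### Isomorphisms from bijections between the vertices -/

open Classical in
/-- An edge of an `h`-diagram is determined by its colour and its source. -/
noncomputable def edgeEquiv (n : ℕ) : F.E n ≃ F.V (n + 1) ⊕ F.V (n + 1) where
  toFun e := if e ∈ F.blue n then Sum.inl (F.s e) else Sum.inr (F.s e)
  invFun := Sum.elim h.hasUniqueSources_blue.edge h.hasUniqueSources_red.edge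
  left_inv e := by
    dsimp only
    split_ifs with he
    · exact (h.hasUniqueSources_blue.eq_edge he).symm
    · exact (h.hasUniqueSources_red.eq_edge ((h.blue_or_red e).resolve_left he)).symm
  right_inv w := by
    rcases w with w | w
    · simp [h.hasUniqueSources_blue.edge_mem, h.hasUniqueSources_blue.source_edge]
    · have : h.hasUniqueSources_red.edge w ∉ F.blue n := fun hb =>
        disjoint_left.1 (h.blue_red n _) hb (h.hasUniqueSources_red.edge_mem w)
      simp [this, h.hasUniqueSources_red.source_edge]

theorem exists_blue_or_red_edge {n : ℕ} (e : F.E n) :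
    (∃ w, e = h.hasUniqueSources_blue.edge w) ∨ ∃ w, e = h.hasUniqueSources_red.edge w :=
  (h.blue_or_red e).imp (fun he => ⟨_, h.hasUniqueSources_blue.eq_edge he⟩)
    fun he => ⟨_, h.hasUniqueSources_red.eq_edge he⟩

theorem mem_B_iff {n : ℕ} {v : F.V n} {e : F.E n} : e ∈ F.B v ↔ e ∈ F.blue n ∧ F.r e = v := by
  constructor
  · intro he
    exact ⟨h.isLDiagram.mem_blue he, h.range_blue he⟩
  · rintro ⟨he, rfl⟩
    exact he

theorem mem_R_iff {n : ℕ} {v : F.V n} {e : F.E n} : e ∈ F.R v ↔ e ∈ F.red n ∧ F.r e = v := by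
  constructor
  · intro he
    exact ⟨h.isLDiagram.mem_red he, h.range_red he⟩
  · rintro ⟨he, rfl⟩
    exact he

/-- Bijections between the vertices that commute with the parent maps of both colours extend to
an isomorphism of `h`-diagrams. -/
theorem nonempty_iso (h' : IsHDiagram G) (vert : ∀ n, F.V n ≃ G.V n)
    (hB : ∀ n w, h'.bluePar n (vert (n + 1) w) = vert n (h.bluePar n w))
    (hR : ∀ n w, h'.redPar n (vert (n + 1) w) = vert n (h.redPar n w)) :
    Nonempty (F.Iso G) := by
  let edge : ∀ n, F.E n ≃ G.E n := fun n =>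
    (h.edgeEquiv n).trans ((Equiv.sumCongr (vert (n + 1)) (vert (n + 1))).trans
      (h'.edgeEquiv n).symm)
  have edge_blue : ∀ n w, edge n (h.hasUniqueSources_blue.edge w) =
      h'.hasUniqueSources_blue.edge (vert (n + 1) w) := fun n w => by
    have : h.hasUniqueSources_blue.edge w = (h.edgeEquiv n).symm (Sum.inl w) := rfl
    simp only [edge, this, Equiv.trans_apply, Equiv.apply_symm_apply]
    rfl
  have edge_red : ∀ n w, edge n (h.hasUniqueSources_red.edge w) =
      h'.hasUniqueSources_red.edge (vert (n + 1) w) := fun n w => by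
    have : h.hasUniqueSources_red.edge w = (h.edgeEquiv n).symm (Sum.inr w) := rfl
    simp only [edge, this, Equiv.trans_apply, Equiv.apply_symm_apply]
    rfl
  have map_r : ∀ n e, G.r (edge n e) = vert n (F.r e) := by
    intro n e
    obtain ⟨w, rfl⟩ | ⟨w, rfl⟩ := h.exists_blue_or_red_edge e
    · rw [edge_blue]; exact hB n w
    · rw [edge_red]; exact hR n w
  have map_s : ∀ n e, G.s (edge n e) = vert (n + 1) (F.s e) := by
    intro n e
    obtain ⟨w, rfl⟩ | ⟨w, rfl⟩ := h.exists_blue_or_red_edge e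
    · rw [edge_blue, h.hasUniqueSources_blue.source_edge, h'.hasUniqueSources_blue.source_edge]
    · rw [edge_red, h.hasUniqueSources_red.source_edge, h'.hasUniqueSources_red.source_edge]
  have mem_blue : ∀ n e, e ∈ F.blue n → edge n e ∈ G.blue n := by
    intro n e he
    rw [h.hasUniqueSources_blue.eq_edge he, edge_blue]
    exact h'.hasUniqueSources_blue.edge_mem _
  have mem_red : ∀ n e, e ∈ F.red n → edge n e ∈ G.red n := by
    intro n e he
    rw [h.hasUniqueSources_red.eq_edge he, edge_red]
    exact h'.hasUniqueSources_red.edge_mem _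
  have map_B : ∀ n (v : F.V n), edge n '' F.B v = G.B (vert n v) := by
    intro n v
    ext e
    obtain ⟨e, rfl⟩ := (edge n).surjective e
    rw [(edge n).injective.mem_set_image, h.mem_B_iff, h'.mem_B_iff, map_r,
      (vert n).injective.eq_iff]
    refine and_congr_left fun _ => ⟨mem_blue n e, fun he => ?_⟩
    refine (h.blue_or_red e).resolve_right fun he' => ?_
    exact disjoint_left.1 (h'.blue_red n _) he (mem_red n e he')
  have map_R : ∀ n (v : F.V n), edge n '' F.R v = G.R (vert n v) := by
    intro n v
    ext e
    obtain ⟨e, rfl⟩ := (edge n).surjective e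
    rw [(edge n).injective.mem_set_image, h.mem_R_iff, h'.mem_R_iff, map_r,
      (vert n).injective.eq_iff]
    refine and_congr_left fun _ => ⟨mem_red n e, fun he => ?_⟩
    refine (h.blue_or_red e).resolve_left fun he' => ?_
    exact disjoint_left.1 (h'.blue_red n _) (mem_blue n e he') he
  refine ⟨⟨vert, edge, map_r, map_s, fun n v => ?_, map_B, fun j => map_R (2 * j),
    fun j f hf => ?_⟩⟩
  · rw [h.sep, h'.sep, image_pair, map_B, map_R]
  · have hf' : edge (2 * j) f ∈ G.R (G.r (edge (2 * j) f)) := mem_red _ f hf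
    rw [h.label j f hf, h'.label j _ hf', map_R, map_s]

/-! ### Contractions of `h`-diagrams -/

theorem hasUniqueSources_blue_contract (m : ContractionSeq) :
    (F.contract m).HasUniqueSources (F.contract m).blue := by
  have hB := h.hasUniqueSources_blue
  intro n w
  refine ⟨Sum.inl ⟨hB.path w (m.m n), fun _ _ _ => hB.edge_mem _⟩,
    ⟨⟨rfl, rfl⟩, descend_self hB.par (V := F.V) w⟩, ?_⟩
  rintro (p | p) ⟨hp, hs⟩
  · refine congrArg Sum.inl (Subtype.ext ?_)
    refine hB.path_unique (q := hB.path (F := F) w (m.m n)) (m.lt n).le p.2 (fun _ _ _ => hB.edge_mem _) ?_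
    exact hs.trans (descend_self hB.par (V := F.V) w).symm
  · exact absurd hp.1 (by simp)

/-- In an `h`-diagram, the condition on the sets `R(f)` holds for all paths of red edges. -/
theorem isRed_iff {a l : ℕ} {p : F.Path a l} : p.IsRed ↔ ∀ i hj hl, p.edge i hj hl ∈ F.red i := by
  refine ⟨fun hp => hp.1, fun hp => ⟨hp, fun i hj hl hi => ?_⟩⟩
  obtain ⟨j, rfl⟩ := hi.two_dvd
  rw [h.label j _ (hp ..), p.source_eq, h.mem_R_iff, p.range_eq]
  exact ⟨hp .., rfl⟩

theorem hasUniqueSources_red_contract (m : ContractionSeq) :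
    (F.contract m).HasUniqueSources (F.contract m).red := by
  have hR := h.hasUniqueSources_red
  intro n w
  refine ⟨Sum.inr ⟨hR.path w (m.m n), h.isRed_iff.2 fun _ _ _ => hR.edge_mem _⟩,
    ⟨⟨rfl, rfl⟩, descend_self hR.par (V := F.V) w⟩, ?_⟩
  rintro (p | p) ⟨hp, hs⟩
  · exact absurd hp.1 (by simp)
  · refine congrArg Sum.inr (Subtype.ext ?_)
    refine hR.path_unique (q := hR.path (F := F) w (m.m n)) (m.lt n).le p.2.1 (fun _ _ _ => hR.edge_mem _) ?_
    exact hs.trans (descend_self hR.par (V := F.V) w).symm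

theorem par_blue_contract (m : ContractionSeq)
    (hB : (F.contract m).HasUniqueSources (F.contract m).blue) (n : ℕ) (w : F.V (m.m (n + 1))) :
    hB.par n w = descend h.bluePar w (m.m n) (m.lt n).le := by
  have hb := h.hasUniqueSources_blue
  let e : (F.contract m).E n := Sum.inl ⟨hb.path w (m.m n), fun _ _ _ => hb.edge_mem _⟩
  exact hB.par_eq (e := e) ⟨rfl, rfl⟩ (descend_self hb.par w)

theorem par_red_contract (m : ContractionSeq)
    (hR : (F.contract m).HasUniqueSources (F.contract m).red) (n : ℕ) (w : F.V (m.m (n + 1))) :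
    hR.par n w = descend h.redPar w (m.m n) (m.lt n).le := by
  have hr := h.hasUniqueSources_red
  let e : (F.contract m).E n :=
    Sum.inr ⟨hr.path w (m.m n), h.isRed_iff.2 fun _ _ _ => hr.edge_mem _⟩
  exact hR.par_eq (e := e) ⟨rfl, rfl⟩ (descend_self hr.par w)

end IsHDiagram

/-- The separation built from the colours has just two members if every set `R(f)` consists of
all red edges with range `s(f)`. -/
theorem colourSep_eq {V E : ℕ → Type u} {r : ∀ {n : ℕ}, E n → V n}
    {s : ∀ {n : ℕ}, E n → V (n + 1)} {B R : ∀ {n : ℕ}, V n → Set (E n)}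
    {Rof : ∀ {n : ℕ}, E n → Set (E (n + 1))}
    (hR : ∀ n (w : V (n + 1)), ∃ f : E n, f ∈ R (r f) ∧ s f = w)
    (hRof : ∀ j (f : E (2 * j)), f ∈ R (r f) → Rof f = R (s f)) :
    ∀ {n : ℕ} (v : V n), colourSep V E r s B R Rof v = {B v, R v}
  | 0, v => rfl
  | k + 1, v => by
    ext A
    simp only [colourSep, mem_ofPred_eq, mem_insert_iff, mem_singleton_iff]
    refine or_congr_right ⟨?_, fun hA => ?_⟩
    · rintro (⟨-, h⟩ | ⟨hk, f, hf, rfl, rfl⟩)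
      · exact h
      · obtain ⟨j, rfl⟩ : ∃ j, k = 2 * j := by
          obtain ⟨j, hj⟩ := hk
          exact ⟨j, by omega⟩
        exact hRof j f hf
    · rcases Nat.even_or_odd (k + 1) with hk | hk
      · exact Or.inl ⟨hk, hA⟩
      · obtain ⟨f, hf, hs⟩ := hR k v
        refine Or.inr ⟨hk, f, hf, hs, ?_⟩
        obtain ⟨j, rfl⟩ : ∃ j, k = 2 * j := by
          obtain ⟨j, hj⟩ := hk
          exact ⟨j, by omega⟩
        rw [hA, hRof j f hf, hs]

/-- Contractions of `h`-diagrams are `h`-diagrams. -/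
theorem IsHDiagram.contract {F : PreDiagram.{u}} (h : IsHDiagram F) (m : ContractionSeq) :
    IsHDiagram (F.contract m) := by
  have hB := h.hasUniqueSources_blue_contract m
  have hR := h.hasUniqueSources_red_contract m
  have label : ∀ j (f : (F.contract m).E (2 * j)), f ∈ (F.contract m).R ((F.contract m).r f) →
      (F.contract m).Rof f = (F.contract m).R ((F.contract m).s f) := by
    intro j f hf
    obtain f | f := f
    · exact absurd hf.1 (by simp)
    have hlt := m.lt (2 * j)
    have hm₁ := m.mod_two (2 * j + 1)
    obtain ⟨i, hi⟩ : ∃ i, m.m (2 * j + 1) = 2 * i + 1 := ⟨m.m (2 * j + 1) / 2, by omega⟩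
    have hlast : ∀ k h₁ h₂, Even k → F.Rof (f.1.edge k h₁ h₂) = F.R (f.1.vert (k + 1)
        (Nat.le_succ_of_le h₁) h₂) := by
      intro k h₁ h₂ hk
      obtain ⟨l, rfl⟩ := hk.two_dvd
      rw [h.label l _ (f.2.1 _ h₁ h₂), f.1.source_eq]
    have hmem : ∀ (g : (F.contract m).E (2 * j + 1)) (k : ℕ) (h₁ : m.m (2 * j) ≤ k)
        (h₂ : k + 1 = m.m (2 * j + 1)) (h₃ : k + 1 < m.m (2 * j + 1 + 1)),
        g.path.edge (k + 1) h₂.ge h₃ ∈ F.R (f.1.vert (k + 1) (Nat.le_succ_of_le h₁) h₂.le) →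
        g.r = f.1.vert (m.m (2 * j + 1)) hlt.le le_rfl := by
      intro g k h₁ h₂ h₃ hg
      have := h.range_red hg
      rw [g.path.range_eq] at this
      have e₁ : ∀ l (hl : k + 1 = l) (a : m.m (2 * j + 1) ≤ l) (b : l ≤ m.m (2 * j + 1 + 1))
          (c : m.m (2 * j) ≤ l) (d : l ≤ m.m (2 * j + 1)),
          g.path.vert l a b = f.1.vert l c d := by
        rintro l rfl _ _ _ _
        exact this
      exact e₁ _ h₂ _ _ _ _
    ext g
    constructor
    · rintro ⟨-, hg, k, h₁, h₂, hmem'⟩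
      refine ⟨hg, ?_⟩
      have hk : Even k := by rw [Nat.even_iff]; omega
      change _ ∈ F.Rof (f.1.edge k h₁ _) at hmem'
      rw [hlast k h₁ _ hk] at hmem'
      exact hmem g k h₁ h₂ _ hmem'
    · rintro ⟨hg, hgr⟩
      have hk : Even (2 * i) := even_two_mul i
      have hle : m.m (2 * j) ≤ 2 * i := by omega
      refine ⟨rfl, hg, 2 * i, hle, hi.symm, ?_⟩
      change _ ∈ F.Rof (f.1.edge (2 * i) hle _)
      rw [hlast _ hle _ hk, h.mem_R_iff, g.path.range_eq]
      obtain g | g := g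
      · exact absurd hg (by simp)
      refine ⟨g.2.1 .., ?_⟩
      have e₁ : ∀ l (hl : m.m (2 * j + 1) = l) (a : m.m (2 * j + 1) ≤ l)
          (b : l ≤ m.m (2 * j + 1 + 1)) (c : m.m (2 * j) ≤ l) (d : l ≤ m.m (2 * j + 1)),
          g.1.vert l a b = f.1.vert l c d := by
        rintro l rfl _ _ _ _
        exact hgr
      exact e₁ _ hi _ _ _ _
  refine isHDiagram_of (fun n => h.finite_V _) (fun n => h.nonempty_V _) hB hR
    (fun n v e he => he.2) (fun n v e he => he.2) (fun n v => ?_) (fun n v => ?_)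
    (fun n e => ?_) (fun n v => ?_) (fun n w => ?_) (fun n v => ?_) label
  · obtain ⟨w, hw⟩ := descend_surjective h.bluePar h.bluePar_surjective (m.lt n).le v
    refine ⟨hB.edge w, ⟨(hB.edge_mem w).1, ?_⟩⟩
    exact (h.par_blue_contract m hB n w).trans hw
  · obtain ⟨w, hw⟩ := descend_surjective h.redPar h.redPar_surjective (m.lt n).le v
    refine ⟨hR.edge w, ⟨(hR.edge_mem w).1, ?_⟩⟩
    exact (h.par_red_contract m hR n w).trans hw
  · obtain e | e := e
    exacts [Or.inl ⟨rfl, rfl⟩, Or.inr ⟨rfl, rfl⟩]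
  · refine disjoint_left.2 ?_
    rintro (e | e) h₁ h₂
    exacts [absurd h₂.1 (by simp), absurd h₁.1 (by simp)]
  · have hb : hB.par n (hB.par (n + 1) w) = descend h.bluePar (V := F.V) w (m.m n)
        ((m.lt n).le.trans (m.lt (n + 1)).le) :=
      (h.par_blue_contract m hB n _).trans ((congrArg (fun v => descend h.bluePar v (m.m n) _)
        (h.par_blue_contract m hB (n + 1) w)).trans (descend_descend ..))
    have hr : hR.par n (hR.par (n + 1) w) = descend h.redPar (V := F.V) w (m.m n)
        ((m.lt n).le.trans (m.lt (n + 1)).le) :=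
      (h.par_red_contract m hR n _).trans ((congrArg (fun v => descend h.redPar v (m.m n) _)
        (h.par_red_contract m hR (n + 1) w)).trans (descend_descend ..))
    refine hb.trans (Eq.trans ?_ hr.symm)
    refine descend_eq_of_even _ _ h.bluePar_bluePar _ ?_ w
    have h₁ := m.mod_two n
    have h₂ := m.mod_two (n + 1 + 1)
    rw [Nat.even_iff]
    omega
  · refine colourSep_eq (fun n w => ?_) label v
    exact ⟨hR.edge w, hR.edge_mem w, hR.source_edge w⟩

/-! ### The topology of the space of infinite blue paths -/

section PathSpace

variable {F : PreDiagram.{u}}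

/-- The sets of paths through a given vertex form a neighbourhood basis. -/
theorem IsLDiagram.exists_vtx_subset (h : IsLDiagram F) {U : Set F.PathSpace} (hU : IsOpen U)
    {x : F.PathSpace} (hx : x ∈ U) : ∃ n, {y : F.PathSpace | y.vtx n = x.vtx n} ⊆ U := by
  induction hU with
  | basic A hA =>
    obtain ⟨z, n, rfl⟩ := hA
    rw [h.cylinder_eq] at hx ⊢
    exact ⟨n + 1, fun y hy => Eq.trans hy hx⟩
  | univ => exact ⟨0, subset_univ _⟩
  | inter A B _ _ ihA ihB =>
    obtain ⟨n, hn⟩ := ihA hx.1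
    obtain ⟨k, hk⟩ := ihB hx.2
    exact ⟨max n k, fun y hy => ⟨hn (h.vtx_eq_of_le (le_max_left ..) hy),
      hk (h.vtx_eq_of_le (le_max_right ..) hy)⟩⟩
  | sUnion S _ ih =>
    obtain ⟨A, hA, hxA⟩ := hx
    obtain ⟨n, hn⟩ := ih A hA hxA
    exact ⟨n, hn.trans (subset_sUnion_of_mem hA)⟩

/-- Recording the vertices embeds the path space as a closed subspace of a product of discrete
spaces. -/
theorem IsLDiagram.isClosedEmbedding_vtx (h : IsLDiagram F) [∀ n, TopologicalSpace (F.V n)]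
    [∀ n, DiscreteTopology (F.V n)] :
    IsClosedEmbedding fun (x : F.PathSpace) (n : ℕ) => x.vtx n := by
  have hcont : Continuous fun (x : F.PathSpace) (n : ℕ) => x.vtx n :=
    continuous_pi fun n => continuous_discrete_rng.2 fun v => isOpen_setOf_vtx n v
  refine ⟨⟨⟨le_antisymm hcont.le_induced ?_⟩, fun x y hxy => ?_⟩, ?_⟩
  · refine le_generateFrom ?_
    rintro _ ⟨x, n, rfl⟩
    rw [h.cylinder_eq]
    exact ⟨{v | v (n + 1) = x.vtx (n + 1)},
      (isOpen_discrete {x.vtx (n + 1)}).preimage (continuous_apply (n + 1)), rfl⟩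
  · exact h.pathSpace_ext fun n => ⟨n, le_rfl, congrFun hxy n⟩
  · have : range (fun (x : F.PathSpace) (n : ℕ) => x.vtx n) =
        ⋂ n, {v : ∀ n, F.V n | h.par n (v (n + 1)) = v n} := by
      ext v
      rw [mem_iInter]
      constructor
      · rintro ⟨x, rfl⟩ n
        exact h.par_vtx x n
      · intro hv
        exact ⟨h.ofVerts v hv, funext (h.vtx_ofVerts v hv)⟩
    rw [this]
    refine isClosed_iInter fun n => ?_
    have hp : Continuous (h.par n) := continuous_of_discreteTopology
    exact isClosed_eq (hp.comp (continuous_apply (n + 1))) (continuous_apply n)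

theorem IsLDiagram.compactSpace (h : IsLDiagram F) : CompactSpace F.PathSpace := by
  let _ : ∀ n, TopologicalSpace (F.V n) := fun _ => ⊥
  have : ∀ n, DiscreteTopology (F.V n) := fun _ => ⟨rfl⟩
  have := h.finite_V
  exact h.isClosedEmbedding_vtx.compactSpace

theorem IsLDiagram.metrizableSpace (h : IsLDiagram F) :
    TopologicalSpace.MetrizableSpace F.PathSpace := by
  let _ : ∀ n, TopologicalSpace (F.V n) := fun _ => ⊥
  have : ∀ n, DiscreteTopology (F.V n) := fun _ => ⟨rfl⟩
  exact h.isClosedEmbedding_vtx.isEmbedding.metrizableSpace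

theorem IsLDiagram.totallyDisconnectedSpace (h : IsLDiagram F) :
    TotallyDisconnectedSpace F.PathSpace := by
  let _ : ∀ n, TopologicalSpace (F.V n) := fun _ => ⊥
  have : ∀ n, DiscreteTopology (F.V n) := fun _ => ⟨rfl⟩
  exact ⟨h.isClosedEmbedding_vtx.isEmbedding.isTotallyDisconnected
    (isTotallyDisconnected_of_totallyDisconnectedSpace _)⟩

/-- Every vertex of an `h`-diagram lies on an infinite blue path. -/
theorem IsHDiagram.exists_vtx_eq (h : IsHDiagram F) (n : ℕ) (v : F.V n) :
    ∃ x : F.PathSpace, x.vtx n = v := by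
  choose up hup using h.bluePar_surjective
  let u : ∀ k, F.V (n + k) := fun k => Nat.rec v (fun k w => up (n + k) w) k
  have hu : ∀ k, h.bluePar (n + k) (u (k + 1)) = u k := fun k => hup _ _
  refine ⟨h.isLDiagram.ofVerts
    (fun i => descend h.bluePar (u i) i (Nat.le_add_left i n)) fun i => ?_, ?_⟩
  · refine (descend_of_lt h.bluePar (u (i + 1)) (Nat.le_add_left (i + 1) n)).symm.trans ?_
    refine (descend_succ h.bluePar (u (i + 1)) (Nat.le_add_left i n)).trans ?_
    exact congrArg (fun w => descend h.bluePar w i _) (hu i)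
  · rw [h.isLDiagram.vtx_ofVerts]
    have key : ∀ k, descend h.bluePar (u k) n (Nat.le_add_right n k) = v := by
      intro k
      induction k with
      | zero => exact descend_self ..
      | succ k ih =>
        exact (descend_succ h.bluePar (u (k + 1)) (Nat.le_add_right n k)).trans
          ((congrArg (fun w => descend h.bluePar w n _) (hu k)).trans ih)
    exact key n

end PathSpace

/-! ### The homeomorphism attached to an `h`-diagram -/

namespace IsHDiagram

variable {F : PreDiagram.{u}} (h : IsHDiagram F)
include h

theorem mapsTo_iff {x y : F.PathSpace} :
    F.MapsTo x y ↔ ∀ j, h.redPar (2 * j + 1) (x.vtx (2 * j + 2)) = y.vtx (2 * j + 1) := by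
  rw [h.isLDiagram.mapsTo_iff]
  exact forall_congr' fun j => h.redStep_iff

theorem bluePar_vtx (x : F.PathSpace) (n : ℕ) : h.bluePar n (x.vtx (n + 1)) = x.vtx n :=
  h.isLDiagram.par_vtx x n

theorem redPar_redPar_vtx (x : F.PathSpace) (n : ℕ) :
    h.redPar n (h.redPar (n + 1) (x.vtx (n + 2))) = x.vtx n := by
  rw [← h.bluePar_bluePar, h.bluePar_vtx, h.bluePar_vtx]

theorem mapsTo_iff' {x y : F.PathSpace} :
    F.MapsTo x y ↔ ∀ j, h.redPar (2 * j) (y.vtx (2 * j + 1)) = x.vtx (2 * j) := by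
  rw [h.mapsTo_iff]
  constructor
  · intro H j
    rw [← H, h.redPar_redPar_vtx]
  · intro H j
    rw [← h.redPar_redPar_vtx y (2 * j + 1)]
    exact (congrArg _ (H (j + 1))).symm

theorem redPar_bluePar_bluePar (n : ℕ) (w : F.V (n + 3)) :
    h.redPar n (h.bluePar (n + 1) (h.bluePar (n + 2) w)) =
      h.bluePar n (h.bluePar (n + 1) (h.redPar (n + 2) w)) := by
  rw [h.bluePar_bluePar, h.bluePar_bluePar]

/-- A compatible sequence of vertices is determined by its terms in the odd layers. -/
theorem exists_vtx_odd (a : ∀ j, F.V (2 * j + 1))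
    (ha : ∀ j, h.bluePar (2 * j + 1) (h.bluePar (2 * j + 2) (a (j + 1))) = a j) :
    ∃ y : F.PathSpace, ∀ j, y.vtx (2 * j + 1) = a j := by
  obtain ⟨v, hv₀, hv₁⟩ := exists_even_odd (fun j => h.bluePar (2 * j) (a j)) a
  refine ⟨h.isLDiagram.ofVerts v fun n => ?_, fun j => ?_⟩
  · obtain ⟨j, rfl | rfl⟩ := n.even_or_odd'
    · rw [hv₁, hv₀]
    · have h₀ : v (2 * j + 1 + 1) = h.bluePar (2 * j + 2) (a (j + 1)) := hv₀ (j + 1)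
      rw [hv₁, h₀]
      exact ha j
  · rw [h.isLDiagram.vtx_ofVerts, hv₁]

/-- A compatible sequence of vertices is determined by its terms in the even layers. -/
theorem exists_vtx_even (a : ∀ j, F.V (2 * j))
    (ha : ∀ j, h.bluePar (2 * j) (h.bluePar (2 * j + 1) (a (j + 1))) = a j) :
    ∃ x : F.PathSpace, ∀ j, x.vtx (2 * j) = a j := by
  obtain ⟨v, hv₀, hv₁⟩ := exists_even_odd a fun j => h.bluePar (2 * j + 1) (a (j + 1))
  refine ⟨h.isLDiagram.ofVerts v fun n => ?_, fun j => ?_⟩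
  · obtain ⟨j, rfl | rfl⟩ := n.even_or_odd'
    · rw [hv₁, hv₀]
      exact ha j
    · have h₀ : v (2 * j + 1 + 1) = a (j + 1) := hv₀ (j + 1)
      rw [hv₁, h₀]
  · rw [h.isLDiagram.vtx_ofVerts, hv₀]

theorem exists_mapsTo (x : F.PathSpace) : ∃ y, F.MapsTo x y := by
  obtain ⟨y, hy⟩ := h.exists_vtx_odd (fun j => h.redPar (2 * j + 1) (x.vtx (2 * j + 2)))
    fun j => by
      refine (h.redPar_bluePar_bluePar (2 * j + 1) (x.vtx (2 * j + 4))).symm.trans ?_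
      rw [h.bluePar_vtx x (2 * j + 3), h.bluePar_vtx x (2 * j + 2)]
  exact ⟨y, h.mapsTo_iff.2 fun j => (hy j).symm⟩

theorem exists_mapsTo' (y : F.PathSpace) : ∃ x, F.MapsTo x y := by
  obtain ⟨x, hx⟩ := h.exists_vtx_even (fun j => h.redPar (2 * j) (y.vtx (2 * j + 1)))
    fun j => by
      refine (h.redPar_bluePar_bluePar (2 * j) (y.vtx (2 * j + 3))).symm.trans ?_
      rw [h.bluePar_vtx y (2 * j + 2), h.bluePar_vtx y (2 * j + 1)]
  exact ⟨x, h.mapsTo_iff'.2 fun j => (hx j).symm⟩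

theorem mapsTo_right_unique {x y y' : F.PathSpace} (hy : F.MapsTo x y) (hy' : F.MapsTo x y') :
    y = y' :=
  h.isLDiagram.pathSpace_ext fun n => ⟨2 * n + 1, by omega,
    (h.mapsTo_iff.1 hy n).symm.trans (h.mapsTo_iff.1 hy' n)⟩

theorem mapsTo_left_unique {x x' y : F.PathSpace} (hx : F.MapsTo x y) (hx' : F.MapsTo x' y) :
    x = x' :=
  h.isLDiagram.pathSpace_ext fun n => ⟨2 * n, by omega,
    (h.mapsTo_iff'.1 hx n).symm.trans (h.mapsTo_iff'.1 hx' n)⟩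

/-- `MapsTo` is the graph of a homeomorphism. -/
theorem exists_homeomorph : ∃ T : F.PathSpace ≃ₜ F.PathSpace, ∀ x y, F.MapsTo x y ↔ y = T x := by
  choose T hT using h.exists_mapsTo
  choose U hU using h.exists_mapsTo'
  refine ⟨⟨⟨T, U, fun x => h.mapsTo_left_unique (hU _) (hT x),
    fun y => h.mapsTo_right_unique (hT _) (hU y)⟩, ?_, ?_⟩, fun x y => ?_⟩
  · -- The `n`-th vertex of `T x` is the blue ancestor of its vertex in the odd layer `2n + 1`.
    refine h.isLDiagram.continuous_of_factor fun n => ⟨2 * n + 2,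
      fun v => descend h.bluePar (h.redPar (2 * n + 1) v) n (by omega), fun x => ?_⟩
    change (T x).vtx n = descend h.bluePar (h.redPar (2 * n + 1) (x.vtx (2 * n + 2))) n _
    rw [h.mapsTo_iff.1 (hT x) n, descend_seq h.bluePar (T x).vtx (h.bluePar_vtx _)]
  · refine h.isLDiagram.continuous_of_factor fun n => ⟨2 * n + 1,
      fun v => descend h.bluePar (h.redPar (2 * n) v) n (by omega), fun y => ?_⟩
    change (U y).vtx n = descend h.bluePar (h.redPar (2 * n) (y.vtx (2 * n + 1))) n _
    rw [h.mapsTo_iff'.1 (hU y) n, descend_seq h.bluePar (U y).vtx (h.bluePar_vtx _)]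
  · constructor
    · exact fun hxy => h.mapsTo_right_unique hxy (hT x)
    · rintro rfl
      exact hT x

/-- The homeomorphism `φ_F` of the space of infinite blue paths. -/
noncomputable def pathHomeo : F.PathSpace ≃ₜ F.PathSpace := h.exists_homeomorph.choose

theorem mapsTo_iff_eq (x y : F.PathSpace) : F.MapsTo x y ↔ y = h.pathHomeo x :=
  h.exists_homeomorph.choose_spec x y

theorem isLHomeo_pathHomeo : IsLHomeo F.PathSpace h.pathHomeo where
  nonempty := by
    obtain ⟨v⟩ := h.nonempty_V 0
    exact ⟨(h.exists_vtx_eq 0 v).choose⟩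
  compact := h.isLDiagram.compactSpace
  metrizable := h.isLDiagram.metrizableSpace
  totallyDisconnected := h.isLDiagram.totallyDisconnectedSpace
  isLocalHomeomorph := h.pathHomeo.isLocalHomeomorph
  surjective := h.pathHomeo.surjective

end IsHDiagram

/-- The system `(X_F, φ_F)`. -/
noncomputable def HDiag.toHomeo (F : HDiag.{u}) : Homeo.{u} :=
  ⟨⟨F.1.PathSpace, F.2.pathHomeo, F.2.isLHomeo_pathHomeo⟩, F.2.pathHomeo.isHomeomorph⟩

theorem HDiag.toHomeo_equiv {F G : HDiag.{u}} (h : F ≈ G) : F.toHomeo ≈ G.toHomeo := by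
  obtain ⟨T, hT⟩ := LDiag.pathConj (F := F.toLDiag) (G := G.toLDiag) h
  refine ⟨T, funext fun x => ?_⟩
  have h₁ : F.1.MapsTo x (F.2.pathHomeo x) := (F.2.mapsTo_iff_eq _ _).2 rfl
  exact (G.2.mapsTo_iff_eq _ _).1 ((hT _ _).1 h₁)

/-! ### Red inclusions between sets -/

section RedSub

variable {X : Type u}

/-- The condition on `W` and `Z` that defines the red edges of the layer `n`. -/
def RedSub (σ : X → X) (n : ℕ) (W Z : Set X) : Prop :=
  (Even n → W ⊆ σ '' Z) ∧ (Odd n → W ⊆ σ ⁻¹' Z)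

theorem RedSub.mono {σ : X → X} {n : ℕ} {W W' Z Z' : Set X} (h : RedSub σ n W Z) (hW : W' ⊆ W)
    (hZ : Z ⊆ Z') : RedSub σ n W' Z' :=
  ⟨fun hn => hW.trans ((h.1 hn).trans (image_mono hZ)),
    fun hn => hW.trans ((h.2 hn).trans (preimage_mono hZ))⟩

theorem RedSub.congr {σ : X → X} {n k : ℕ} {W Z : Set X} (h : RedSub σ n W Z)
    (hnk : n % 2 = k % 2) : RedSub σ k W Z := by
  simp only [RedSub, Nat.even_iff, Nat.odd_iff, hnk] at h ⊢
  exact h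

/-- Two successive red steps give an inclusion. -/
theorem RedSub.subset {σ : X → X} (hσ : Function.Injective σ) {n : ℕ} {W Z Y : Set X}
    (h₁ : RedSub σ (n + 1) W Z) (h₀ : RedSub σ n Z Y) : W ⊆ Y := by
  intro x hx
  rcases Nat.even_or_odd n with hn | hn
  · obtain ⟨y, hy, e⟩ := h₀.1 hn (h₁.2 hn.add_one hx)
    rwa [← hσ e]
  · obtain ⟨z, hz, rfl⟩ := h₁.1 hn.add_one hx
    exact h₀.2 hn hz

/-- `Q` refines `P`, its image and its preimage. -/
def RefinesBoth (σ : X → X) (P Q : Set (Set X)) : Prop :=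
  ∀ W ∈ Q, (∃ Z ∈ P, W ⊆ Z) ∧ (∃ Z ∈ P, W ⊆ σ '' Z) ∧ ∃ Z ∈ P, W ⊆ σ ⁻¹' Z

theorem RefinesBoth.redSub {σ : X → X} {P Q : Set (Set X)} (h : RefinesBoth σ P Q) (n : ℕ)
    {W : Set X} (hW : W ∈ Q) : ∃ Z ∈ P, RedSub σ n W Z := by
  rcases Nat.even_or_odd n with hn | hn
  · obtain ⟨Z, hZ, hWZ⟩ := (h W hW).2.1
    exact ⟨Z, hZ, fun _ => hWZ, fun ho => absurd hn (Nat.not_even_iff_odd.2 ho)⟩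
  · obtain ⟨Z, hZ, hWZ⟩ := (h W hW).2.2
    exact ⟨Z, hZ, fun he => absurd he (Nat.not_even_iff_odd.2 hn), fun _ => hWZ⟩

theorem image_mem_forwardPartition {σ : X → X} (hσ : Function.Injective σ) {P : Set (Set X)}
    {Z : Set X} (hZ : Z ∈ P) (hne : Z.Nonempty) : σ '' Z ∈ forwardPartition σ P := by
  refine ⟨hne.image σ, {Z}, Finset.singleton_nonempty Z, by simpa using hZ, ?_⟩
  have : atLeast σ 2 = ∅ := by
    refine eq_empty_of_forall_notMem fun x hx => ?_
    have h₁ : (σ ⁻¹' {x}).encard ≤ 1 :=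
      encard_le_one_iff_subsingleton.2 (subsingleton_singleton.preimage hσ)
    have h₂ : ((2 : ℕ) : ℕ∞) ≤ 1 := le_trans hx h₁
    exact absurd h₂ (by norm_num)
  simp [this]

end RedSub

theorem exists_seq_of_forall_exists {α : Type*} (a : α) (R : ℕ → α → α → Prop)
    (h : ∀ n a, ∃ b, R n a b) : ∃ f : ℕ → α, f 0 = a ∧ ∀ n, R n (f n) (f (n + 1)) := by
  choose g hg using h
  exact ⟨fun n => Nat.rec a (fun n b => g n b) n, rfl, fun n => hg _ _⟩

/-! ### Clopen partitions and towers of partitions -/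

section Partition

variable {X : Type u} [TopologicalSpace X]

namespace IsClopenPartition

variable {P : Set (Set X)} (h : IsClopenPartition P)
include h

theorem exists_mem (x : X) : ∃ Z ∈ P, x ∈ Z := by
  have : x ∈ ⋃₀ P := by rw [h.union]; trivial
  exact this

theorem eq_of_mem {Z Z' : Set X} (hZ : Z ∈ P) (hZ' : Z' ∈ P) {x : X} (hx : x ∈ Z)
    (hx' : x ∈ Z') : Z = Z' := by
  by_contra hne
  exact disjoint_left.1 (h.disjoint hZ hZ' hne) hx hx'

end IsClopenPartition

/-- Every family of open neighbourhoods is refined by a clopen partition. -/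
theorem exists_isClopenPartition [T2Space X] [CompactSpace X] [TotallyDisconnectedSpace X]
    (U : X → Set X) (hU : ∀ x, IsOpen (U x)) (hx : ∀ x, x ∈ U x) :
    ∃ Q, IsClopenPartition Q ∧ ∀ Z ∈ Q, ∃ x, Z ⊆ U x := by
  have hc : TopologicalSpace.IsOpenCover fun x => (⟨U x, hU x⟩ : TopologicalSpace.Opens X) :=
    eq_top_iff.2 fun x _ => TopologicalSpace.Opens.mem_iSup.2 ⟨x, hx x⟩
  obtain ⟨n, W, hW, hun, hd⟩ := hc.exists_finite_nonempty_disjoint_clopen_cover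
  refine ⟨range fun j => (W j : Set X), ⟨finite_range _, ?_, ?_, ?_, ?_⟩, ?_⟩
  · rintro _ ⟨j, rfl⟩
    rw [nonempty_iff_ne_empty]
    exact fun e => (hW j).1 (SetLike.coe_injective e)
  · rintro _ ⟨j, rfl⟩
    exact (W j).isClopen
  · rintro _ ⟨i, rfl⟩ _ ⟨j, rfl⟩ hne
    have hij : i ≠ j := fun e => hne (by rw [e])
    have := hd hij
    refine disjoint_left.2 fun x hxi hxj => ?_
    have hle : (W i ⊓ W j) = ⊥ := disjoint_iff.1 this
    have hmem : x ∈ W i ⊓ W j := ⟨hxi, hxj⟩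
    rw [hle] at hmem
    exact hmem
  · rw [sUnion_range]
    exact univ_subset_iff.1 hun
  · rintro _ ⟨j, rfl⟩
    exact (hW j).2

theorem IsClopenPartition.eq_of_redSub {σ : X → X} (hσ : Function.Injective σ) {P : Set (Set X)}
    (h : IsClopenPartition P) {n : ℕ} {W Z Z' : Set X} (hW : W.Nonempty) (hZ : Z ∈ P)
    (hZ' : Z' ∈ P) (h₁ : RedSub σ n W Z) (h₂ : RedSub σ n W Z') : Z = Z' := by
  obtain ⟨x, hx⟩ := hW
  rcases Nat.even_or_odd n with hn | hn
  · obtain ⟨y, hy, rfl⟩ := h₁.1 hn hx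
    obtain ⟨z, hz, e⟩ := h₂.1 hn hx
    rw [hσ e] at hz
    exact h.eq_of_mem hZ hZ' hy hz
  · exact h.eq_of_mem hZ hZ' (h₁.2 hn hx) (h₂.2 hn hx)

/-- The combinatorial content of a refined sequence of partitions for an invertible map. -/
structure IsTower (σ : X → X) (P : ℕ → Set (Set X)) : Prop where
  partition : ∀ n, IsClopenPartition (P n)
  refines : ∀ n, ∀ W ∈ P (n + 1), ∃ Z ∈ P n, W ⊆ Z
  red : ∀ n, ∀ W ∈ P (n + 1), ∃ Z ∈ P n, RedSub σ n W Z
  small : ∀ U, IsOpen U → ∀ x ∈ U, ∃ n, ∃ Z ∈ P n, x ∈ Z ∧ Z ⊆ U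

namespace IsTower

variable {σ : X → X} {P : ℕ → Set (Set X)}

theorem exists_superset (h : IsTower σ P) {n k : ℕ} (hnk : n ≤ k) {W : Set X} (hW : W ∈ P k) :
    ∃ Z ∈ P n, W ⊆ Z := by
  induction k, hnk using Nat.le_induction generalizing W with
  | base => exact ⟨W, hW, Subset.rfl⟩
  | succ k hk ih =>
    obtain ⟨Z, hZ, hWZ⟩ := h.refines k W hW
    obtain ⟨Y, hY, hZY⟩ := ih hZ
    exact ⟨Y, hY, hWZ.trans hZY⟩

/-- The members of a tower that contain a point shrink. -/
theorem subset_of_le (h : IsTower σ P) {n k : ℕ} (hnk : n ≤ k) {W Z : Set X} (hW : W ∈ P k)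
    (hZ : Z ∈ P n) {x : X} (hxW : x ∈ W) (hxZ : x ∈ Z) : W ⊆ Z := by
  obtain ⟨Y, hY, hWY⟩ := h.exists_superset hnk hW
  rwa [(h.partition n).eq_of_mem hZ hY hxZ (hWY hxW)]

/-- The partitions of a tower are eventually subordinate to every open cover. -/
theorem exists_subordinate [CompactSpace X] (h : IsTower σ P) (U : X → Set X)
    (hU : ∀ x, IsOpen (U x)) (hx : ∀ x, x ∈ U x) :
    ∃ N, ∀ n ≥ N, ∀ Z ∈ P n, ∃ x, Z ⊆ U x := by
  choose k Z hZ hxZ hZU using fun x => h.small (U x) (hU x) x (hx x)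
  obtain ⟨t, ht⟩ := isCompact_univ.elim_finite_subcover Z
    (fun x => ((h.partition _).clopen _ (hZ x)).isOpen) fun x _ => mem_iUnion.2 ⟨x, hxZ x⟩
  refine ⟨t.sup k, fun n hn W hW => ?_⟩
  obtain ⟨y, hy⟩ := (h.partition n).nonempty W hW
  obtain ⟨x, hxt, hyx⟩ := mem_iUnion₂.1 (ht (mem_univ y))
  exact ⟨x, (h.subset_of_le ((Finset.le_sup hxt).trans hn) hW (hZ x) hy hyx).trans (hZU x)⟩

end IsTower

/-! ### Refined sequences for homeomorphisms -/

theorem IsRefinedSeq.isTower [TopologicalSpace.MetrizableSpace X] {σ : X → X}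
    {P : ℕ → Set (Set X)} (h : IsRefinedSeq σ P) : IsTower σ P := by
  have hchain : ∀ n k, n ≤ k → ∀ W ∈ P k, ∃ Z ∈ P n, W ⊆ Z := by
    intro n k hnk
    induction k, hnk using Nat.le_induction with
    | base => exact fun W hW => ⟨W, hW, Subset.rfl⟩
    | succ k hk ih =>
      intro W hW
      obtain ⟨Z, hZ, hWZ⟩ := h.refines k W hW
      obtain ⟨Y, hY, hZY⟩ := ih Z hZ
      exact ⟨Y, hY, hWZ.trans hZY⟩
  refine ⟨h.partition, h.refines, fun n W hW => ?_, fun U hU => ?_⟩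
  · obtain ⟨j, rfl | rfl⟩ := n.even_or_odd'
    · obtain ⟨_, ⟨-, Z₁, -, Z₂, ⟨-, T, ⟨Z, hZT⟩, hT, rfl⟩, rfl⟩, hsub⟩ := h.even j W hW
      refine ⟨Z, hT Z hZT, fun _ => ?_, fun hn => absurd (even_two_mul j)
        (Nat.not_even_iff_odd.2 hn)⟩
      exact fun x hx => mem_iInter₂.1 (hsub hx).2.1 Z hZT
    · obtain ⟨_, ⟨-, Z₁, -, _, ⟨Z, hZ, rfl⟩, rfl⟩, hsub⟩ := h.odd j W hW
      refine ⟨Z, hZ, fun hn => ?_, fun _ => hsub.trans inter_subset_right⟩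
      exact absurd hn (Nat.not_even_iff_odd.2 (odd_two_mul_add_one j))
  · have hU' : TopologicalSpace.GenerateOpen (⋃ n, P n) U := by
      rw [h.generates] at hU
      exact hU
    induction hU' with
    | basic A hA =>
      obtain ⟨n, hn⟩ := mem_iUnion.1 hA
      exact fun x hx => ⟨n, A, hn, hx, Subset.rfl⟩
    | univ =>
      intro x _
      obtain ⟨Z, hZ, hx⟩ := (h.partition 0).exists_mem x
      exact ⟨0, Z, hZ, hx, subset_univ _⟩
    | inter A B hA hB ihA ihB =>
      rintro x ⟨hxA, hxB⟩
      have oA : IsOpen A := by rw [h.generates]; exact hA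
      have oB : IsOpen B := by rw [h.generates]; exact hB
      obtain ⟨n, Z, hZ, hxZ, hZA⟩ := ihA oA x hxA
      obtain ⟨k, Y, hY, hxY, hYB⟩ := ihB oB x hxB
      obtain ⟨W, hW, hxW⟩ := (h.partition (max n k)).exists_mem x
      obtain ⟨Z', hZ', hWZ⟩ := hchain n _ (le_max_left n k) W hW
      obtain ⟨Y', hY', hWY⟩ := hchain k _ (le_max_right n k) W hW
      rw [(h.partition n).eq_of_mem hZ' hZ (hWZ hxW) hxZ] at hWZ
      rw [(h.partition k).eq_of_mem hY' hY (hWY hxW) hxY] at hWY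
      exact ⟨_, W, hW, hxW, subset_inter (hWZ.trans hZA) (hWY.trans hYB)⟩
    | sUnion S hS ih =>
      rintro x ⟨A, hA, hxA⟩
      have oA : IsOpen A := by rw [h.generates]; exact hS A hA
      obtain ⟨n, Z, hZ, hxZ, hZA⟩ := ih A hA oA x hxA
      exact ⟨n, Z, hZ, hxZ, hZA.trans (subset_sUnion_of_mem hA)⟩

theorem IsTower.isRefinedSeq [CompactSpace X] [TopologicalSpace.MetrizableSpace X] {σ : X → X}
    (hσ : IsHomeomorph σ) {P : ℕ → Set (Set X)} (h : IsTower σ P) : IsRefinedSeq σ P where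
  partition := h.partition
  homeo Z _ := hσ.isEmbedding.comp IsEmbedding.subtypeVal
  refines := h.refines
  generates := by
    refine (TopologicalSpace.isTopologicalBasis_of_isOpen_of_nhds ?_ ?_).eq_generateFrom
    · intro Z hZ
      obtain ⟨n, hn⟩ := mem_iUnion.1 hZ
      exact ((h.partition n).clopen Z hn).isOpen
    · intro x U hx hU
      obtain ⟨n, Z, hZ, hxZ, hZU⟩ := h.small U hU x hx
      exact ⟨Z, mem_iUnion.2 ⟨n, hZ⟩, hxZ, hZU⟩
  diam := by
    let _ := TopologicalSpace.metrizableSpaceMetric X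
    refine Metric.tendsto_atTop.2 fun ε hε => ?_
    obtain ⟨N, hN⟩ := h.exists_subordinate (fun x => Metric.ball x (ε / 4))
      (fun x => Metric.isOpen_ball) fun x => Metric.mem_ball_self (by positivity)
    refine ⟨N, fun n hn => ?_⟩
    have h₀ : 0 ≤ partitionDiam (P n) := by
      refine Real.sSup_nonneg ?_
      rintro _ ⟨Z, -, rfl⟩
      exact Metric.diam_nonneg
    have h₁ : partitionDiam (P n) ≤ ε / 2 := by
      refine Real.sSup_le ?_ (by positivity)
      rintro _ ⟨Z, hZ, rfl⟩
      obtain ⟨x, hx⟩ := hN n hn Z hZ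
      have h₂ := Metric.diam_mono hx Metric.isBounded_ball
      have h₃ := Metric.diam_ball (x := x) (r := ε / 4) (by positivity)
      linarith
    rw [Real.dist_eq, sub_zero, abs_of_nonneg h₀]
    linarith
  even j W hW := by
    obtain ⟨Z₁, hZ₁, h₁⟩ := h.refines _ W hW
    obtain ⟨Z₂, hZ₂, h₂⟩ := h.red _ W hW
    have hsub := subset_inter h₁ (h₂.1 (even_two_mul j))
    exact ⟨_, ⟨((h.partition _).nonempty W hW).mono hsub, Z₁, hZ₁, _, image_mem_forwardPartition
      hσ.injective hZ₂ ((h.partition _).nonempty _ hZ₂), rfl⟩, hsub⟩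
  odd j W hW := by
    obtain ⟨Z₁, hZ₁, h₁⟩ := h.refines _ W hW
    obtain ⟨Z₂, hZ₂, h₂⟩ := h.red _ W hW
    have hsub := subset_inter h₁ (h₂.2 (odd_two_mul_add_one j))
    exact ⟨_, ⟨((h.partition _).nonempty W hW).mono hsub, Z₁, hZ₁, _, mem_image_of_mem _ hZ₂,
      rfl⟩, hsub⟩

/-! ### Existence of refined sequences -/

/-- Every point has a neighbourhood that is contained in members of `P`, of its image and of its
preimage. -/
theorem IsClopenPartition.exists_nhd {σ : X → X} (hσ : IsHomeomorph σ) {P : Set (Set X)}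
    (h : IsClopenPartition P) (x : X) : ∃ U, IsOpen U ∧ x ∈ U ∧
      (∃ Z ∈ P, U ⊆ Z) ∧ (∃ Z ∈ P, U ⊆ σ '' Z) ∧ ∃ Z ∈ P, U ⊆ σ ⁻¹' Z := by
  obtain ⟨y, rfl⟩ := hσ.surjective x
  obtain ⟨Z₁, h₁, hx₁⟩ := h.exists_mem (σ y)
  obtain ⟨Z₂, h₂, hx₂⟩ := h.exists_mem y
  obtain ⟨Z₃, h₃, hx₃⟩ := h.exists_mem (σ (σ y))
  exact ⟨Z₁ ∩ (σ '' Z₂ ∩ σ ⁻¹' Z₃), (h.clopen _ h₁).isOpen.inter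
    ((hσ.isOpenMap _ (h.clopen _ h₂).isOpen).inter
      ((h.clopen _ h₃).isOpen.preimage hσ.continuous)),
    ⟨hx₁, mem_image_of_mem _ hx₂, hx₃⟩, ⟨Z₁, h₁, inter_subset_left⟩,
    ⟨Z₂, h₂, inter_subset_right.trans inter_subset_left⟩,
    ⟨Z₃, h₃, inter_subset_right.trans inter_subset_right⟩⟩

theorem exists_isTower [Nonempty X] [CompactSpace X] [TopologicalSpace.MetrizableSpace X]
    [TotallyDisconnectedSpace X] {σ : X → X} (hσ : IsHomeomorph σ) : ∃ P, IsTower σ P := by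
  let _ := TopologicalSpace.metrizableSpaceMetric X
  have step : ∀ (n : ℕ) (P : {P : Set (Set X) // IsClopenPartition P}),
      ∃ Q : {P : Set (Set X) // IsClopenPartition P}, RefinesBoth σ P.1 Q.1 ∧
        ∀ Z ∈ Q.1, ∃ x, Z ⊆ Metric.ball x (1 / ((n : ℝ) + 1)) := by
    intro n P
    choose U hU hx h₁ h₂ h₃ using P.2.exists_nhd hσ
    obtain ⟨Q, hQ, hQU⟩ := exists_isClopenPartition
      (fun x => U x ∩ Metric.ball x (1 / ((n : ℝ) + 1)))
      (fun x => (hU x).inter Metric.isOpen_ball)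
      fun x => ⟨hx x, Metric.mem_ball_self (by positivity)⟩
    refine ⟨⟨Q, hQ⟩, fun W hW => ?_, fun W hW => ?_⟩
    · obtain ⟨x, hWx⟩ := hQU W hW
      have hWU := hWx.trans inter_subset_left
      exact ⟨(h₁ x).imp fun Z hZ => ⟨hZ.1, hWU.trans hZ.2⟩,
        (h₂ x).imp fun Z hZ => ⟨hZ.1, hWU.trans hZ.2⟩,
        (h₃ x).imp fun Z hZ => ⟨hZ.1, hWU.trans hZ.2⟩⟩
    · exact (hQU W hW).imp fun x hWx => hWx.trans inter_subset_right
  have trivialPartition : IsClopenPartition {(univ : Set X)} :=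
    ⟨finite_singleton _, by simp, by simp [isClopen_univ], pairwiseDisjoint_singleton .., by simp⟩
  obtain ⟨P, -, hP⟩ := exists_seq_of_forall_exists ⟨_, trivialPartition⟩ _ step
  refine ⟨fun n => (P n).1, fun n => (P n).2, fun n W hW => ((hP n).1 W hW).1,
    fun n W hW => (hP n).1.redSub n hW, fun U hU x hx => ?_⟩
  obtain ⟨ε, hε, hεU⟩ := Metric.isOpen_iff.1 hU x hx
  obtain ⟨n, hn⟩ := exists_nat_one_div_lt (half_pos hε)
  obtain ⟨Z, hZ, hxZ⟩ := (P (n + 1)).2.exists_mem x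
  refine ⟨n + 1, Z, hZ, hxZ, fun y hy => hεU ?_⟩
  obtain ⟨z, hz⟩ := (hP n).2 Z hZ
  have h₁ := Metric.mem_ball.1 (hz hy)
  have h₂ := Metric.mem_ball'.1 (hz hxZ)
  have h₃ := dist_triangle y z x
  rw [Metric.mem_ball]
  linarith

end Partition

/-! ### The diagram of a tower of partitions -/

section TowerDiagram

variable {X : Type u} [TopologicalSpace X] {σ : X → X} {P : ℕ → Set (Set X)}

namespace IsTower

variable (h : IsTower σ P)
include h

theorem hasUniqueSources_blue :
    (partitionDiagram σ P).HasUniqueSources (partitionDiagram σ P).blue := by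
  rintro n ⟨W, hW⟩
  obtain ⟨Z, hZ, hWZ⟩ := h.refines n W hW
  obtain ⟨x, hx⟩ := (h.partition (n + 1)).nonempty W hW
  refine ⟨Sum.inl ⟨(⟨W, hW⟩, ⟨Z, hZ⟩), hWZ⟩, ⟨⟨rfl, rfl⟩, rfl⟩, ?_⟩
  rintro (⟨⟨⟨W', hW'⟩, ⟨Z', hZ'⟩⟩, hsub⟩ | p) ⟨hp, hs⟩
  · obtain rfl : W' = W := congrArg Subtype.val hs
    obtain rfl : Z' = Z := (h.partition n).eq_of_mem hZ' hZ (hsub hx) (hWZ hx)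
    rfl
  · exact absurd hp.1 (by simp)

theorem hasUniqueSources_red (hσ : Function.Injective σ) :
    (partitionDiagram σ P).HasUniqueSources (partitionDiagram σ P).red := by
  rintro n ⟨W, hW⟩
  obtain ⟨Z, hZ, hWZ⟩ := h.red n W hW
  refine ⟨Sum.inr ⟨(⟨W, hW⟩, ⟨Z, hZ⟩), hWZ⟩, ⟨⟨rfl, rfl⟩, rfl⟩, ?_⟩
  rintro (p | ⟨⟨⟨W', hW'⟩, ⟨Z', hZ'⟩⟩, hsub⟩) ⟨hp, hs⟩
  · exact absurd hp.1 (by simp)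
  · obtain rfl : W' = W := congrArg Subtype.val hs
    obtain rfl : Z' = Z := (h.partition n).eq_of_redSub hσ
      ((h.partition (n + 1)).nonempty W' hW) hZ' hZ hsub hWZ
    rfl

theorem par_blue_eq_iff (hB : (partitionDiagram σ P).HasUniqueSources (partitionDiagram σ P).blue)
    {n : ℕ} {W : P (n + 1)} {Z : P n} : hB.par n W = Z ↔ W.1 ⊆ Z.1 := by
  have key : ∀ Z : P n, W.1 ⊆ Z.1 → hB.par n W = Z := fun Z hZ =>
    hB.par_eq (e := (Sum.inl ⟨(W, Z), hZ⟩ : PartitionEdge σ P n)) ⟨rfl, rfl⟩ rfl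
  refine ⟨?_, key Z⟩
  rintro rfl
  obtain ⟨Z, hZ, hWZ⟩ := h.refines n W.1 W.2
  rw [key ⟨Z, hZ⟩ hWZ]
  exact hWZ

theorem par_red_eq_iff (hR : (partitionDiagram σ P).HasUniqueSources (partitionDiagram σ P).red)
    {n : ℕ} {W : P (n + 1)} {Z : P n} : hR.par n W = Z ↔ RedSub σ n W.1 Z.1 := by
  have key : ∀ Z : P n, RedSub σ n W.1 Z.1 → hR.par n W = Z := fun Z hZ =>
    hR.par_eq (e := (Sum.inr ⟨(W, Z), hZ⟩ : PartitionEdge σ P n)) ⟨rfl, rfl⟩ rfl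
  refine ⟨?_, key Z⟩
  rintro rfl
  obtain ⟨Z, hZ, hWZ⟩ := h.red n W.1 W.2
  rw [key ⟨Z, hZ⟩ hWZ]
  exact hWZ

/-- The diagram of a tower for an invertible map is an `h`-diagram. -/
theorem isHDiagram [Nonempty X] (hσ : Function.Bijective σ) :
    IsHDiagram (partitionDiagram σ P) := by
  have hB := h.hasUniqueSources_blue
  have hR := h.hasUniqueSources_red hσ.injective
  have label : ∀ j (f : (partitionDiagram σ P).E (2 * j)),
      f ∈ (partitionDiagram σ P).R ((partitionDiagram σ P).r f) →
      (partitionDiagram σ P).Rof f = (partitionDiagram σ P).R ((partitionDiagram σ P).s f) := by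
    rintro j (f | f) hf
    · exact absurd hf.1 (by simp)
    ext g
    constructor
    · rintro ⟨-, h₁, h₂, -⟩
      exact ⟨h₁, h₂⟩
    · rintro ⟨h₁, h₂⟩
      refine ⟨rfl, h₁, h₂, ?_⟩
      obtain g | ⟨⟨W, Z⟩, hg⟩ := g
      · exact absurd h₁ (by simp)
      obtain ⟨⟨Z', Y⟩, hf'⟩ := f
      obtain rfl : Z = Z' := h₂
      exact RedSub.subset hσ.injective hg hf'
  refine isHDiagram_of (fun n => (h.partition n).finite.to_subtype) (fun n => ?_) hB hR
    (fun n v e he => he.2) (fun n v e he => he.2) ?_ ?_ (fun n e => ?_) (fun n v => ?_)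
    (fun n w => ?_) (fun n v => ?_) label
  · obtain ⟨Z, hZ, -⟩ := (h.partition n).exists_mem (Classical.arbitrary X)
    exact ⟨⟨Z, hZ⟩⟩
  · rintro n ⟨Z, hZ⟩
    obtain ⟨x, hx⟩ := (h.partition n).nonempty Z hZ
    obtain ⟨W, hW, hxW⟩ := (h.partition (n + 1)).exists_mem x
    exact ⟨Sum.inl ⟨(⟨W, hW⟩, ⟨Z, hZ⟩), h.subset_of_le n.le_succ hW hZ hxW hx⟩, rfl, rfl⟩
  · rintro n ⟨Z, hZ⟩
    obtain ⟨x, hx⟩ := (h.partition n).nonempty Z hZ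
    -- The red edge with source `W` ends at `Z` if `W` contains the point `y`, which is `σ x` for
    -- even `n` and `σ⁻¹ x` for odd `n`.
    obtain ⟨y, hy⟩ : ∃ y, ∀ Y, RedSub σ n {y} Y → x ∈ Y := by
      rcases Nat.even_or_odd n with hn | hn
      · refine ⟨σ x, fun Y hY => ?_⟩
        obtain ⟨z, hz, e⟩ := hY.1 hn rfl
        rwa [← hσ.injective e]
      · obtain ⟨y, rfl⟩ := hσ.surjective x
        exact ⟨y, fun Y hY => hY.2 hn rfl⟩
    obtain ⟨W, hW, hyW⟩ := (h.partition (n + 1)).exists_mem y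
    obtain ⟨Z', hZ', hWZ⟩ := h.red n W hW
    obtain rfl : Z' = Z := (h.partition n).eq_of_mem hZ' hZ
      (hy Z' (hWZ.mono (singleton_subset_iff.2 hyW) Subset.rfl)) hx
    exact ⟨Sum.inr ⟨(⟨W, hW⟩, ⟨Z', hZ⟩), hWZ⟩, rfl, rfl⟩
  · obtain e | e := e
    exacts [Or.inl ⟨rfl, rfl⟩, Or.inr ⟨rfl, rfl⟩]
  · refine disjoint_left.2 ?_
    rintro (e | e) h₁ h₂
    exacts [absurd h₂.1 (by simp), absurd h₁.1 (by simp)]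
  · have b₁ := (h.par_blue_eq_iff hB (W := w)).1 rfl
    have b₀ := (h.par_blue_eq_iff hB (W := hB.par (n + 1) w)).1 rfl
    have r₁ := (h.par_red_eq_iff hR (W := w)).1 rfl
    have r₀ := (h.par_red_eq_iff hR (W := hR.par (n + 1) w)).1 rfl
    obtain ⟨x, hx⟩ := (h.partition (n + 2)).nonempty w.1 w.2
    exact Subtype.ext ((h.partition n).eq_of_mem (Subtype.property _) (Subtype.property _)
      (b₀ (b₁ hx)) (r₁.subset hσ.injective r₀ hx))
  · exact colourSep_eq (fun n w => ⟨hR.edge w, hR.edge_mem w, hR.source_edge w⟩) label v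

end IsTower

/-! ### Recovering the map from the diagram -/

/-- The path system of the diagram of a tower is conjugate to the map. -/
theorem IsTower.exists_homeomorph [CompactSpace X] (h : IsTower σ P)
    (hD : IsHDiagram (partitionDiagram σ P)) [T2Space X] :
    ∃ T : X ≃ₜ (partitionDiagram σ P).PathSpace,
      ∀ x, (partitionDiagram σ P).MapsTo (T x) (T (σ x)) := by
  choose Z hZ hxZ using fun n => (h.partition n).exists_mem
  let T : X → (partitionDiagram σ P).PathSpace := fun x =>
    hD.isLDiagram.ofVerts (fun n => ⟨Z n x, hZ n x⟩) fun n =>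
      (h.par_blue_eq_iff hD.hasUniqueSources_blue).2
        (h.subset_of_le n.le_succ (hZ (n + 1) x) (hZ n x) (hxZ (n + 1) x) (hxZ n x))
  have hT : ∀ x n, (T x).vtx n = (⟨Z n x, hZ n x⟩ : P n) := fun x n =>
    hD.isLDiagram.vtx_ofVerts ..
  have hT_iff : ∀ x n (Y : P n), (T x).vtx n = Y ↔ x ∈ Y.1 := by
    intro x n Y
    rw [hT]
    constructor
    · rintro rfl
      exact hxZ n x
    · exact fun hx => Subtype.ext ((h.partition n).eq_of_mem (hZ n x) Y.2 (hxZ n x) hx)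
  have hcont : Continuous T := by
    refine hD.isLDiagram.continuous_of_vtx fun n Y => ?_
    have : {x | (T x).vtx n = Y} = Y.1 := by
      ext x
      exact hT_iff x n Y
    rw [this]
    exact ((h.partition n).clopen _ Y.2).isOpen
  have hinj : Function.Injective T := by
    intro x y hxy
    by_contra hne
    obtain ⟨n, Y, hY, hxY, hYU⟩ := h.small {y}ᶜ isOpen_compl_singleton x hne
    have h₁ := (hT_iff x n ⟨Y, hY⟩).2 hxY
    rw [hxy] at h₁
    exact hYU ((hT_iff y n ⟨Y, hY⟩).1 h₁) rfl
  have hsurj : Function.Surjective T := by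
    intro p
    let Y : ∀ n, P n := fun n => p.vtx n
    have hY : ∀ n, (Y (n + 1)).1 ⊆ (Y n).1 := fun n =>
      (h.par_blue_eq_iff hD.hasUniqueSources_blue).1 (hD.bluePar_vtx p n)
    obtain ⟨x, hx⟩ := IsCompact.nonempty_iInter_of_sequence_nonempty_isCompact_isClosed
      (fun n => (Y n).1) hY (fun n => (h.partition n).nonempty _ (Y n).2)
      ((h.partition 0).clopen _ (Y 0).2).isClosed.isCompact
      fun n => ((h.partition n).clopen _ (Y n).2).isClosed
    exact ⟨x, hD.isLDiagram.pathSpace_ext fun n =>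
      ⟨n, le_rfl, (hT_iff x n (Y n)).2 (mem_iInter.1 hx n)⟩⟩
  have := hD.isLDiagram.metrizableSpace
  refine ⟨Continuous.homeoOfEquivCompactToT2 (f := Equiv.ofBijective T ⟨hinj, hsurj⟩) hcont,
    fun x => hD.mapsTo_iff.2 fun j => ?_⟩
  change hD.redPar (2 * j + 1) ((T x).vtx (2 * j + 2)) = (T (σ x)).vtx (2 * j + 1)
  rw [hT, hT]
  refine (h.par_red_eq_iff hD.hasUniqueSources_red).2 ?_
  obtain ⟨Y, hY, hsub⟩ := h.red (2 * j + 1) _ (hZ (2 * j + 2) x)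
  have hmem : σ x ∈ Y := hsub.2 (odd_two_mul_add_one j) (hxZ _ x)
  change RedSub σ (2 * j + 1) (Z (2 * j + 2) x) (Z (2 * j + 1) (σ x))
  rw [(h.partition _).eq_of_mem (hZ _ (σ x)) hY (hxZ _ (σ x)) hmem]
  exact hsub

/-! ### Realizing a diagram by a tower -/

/-- If a map is conjugate to the path system of an `h`-diagram, then the sets of points whose
paths run through a given vertex form a tower, and its diagram is the given one. -/
theorem exists_isTower_iso [Nonempty X] (hσ : Function.Bijective σ)
    {G : PreDiagram.{u}} (hG : IsHDiagram G) (T : X ≃ₜ G.PathSpace)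
    (hT : ∀ x, G.MapsTo (T x) (T (σ x))) :
    ∃ P, IsTower σ P ∧ Nonempty (G.Iso (partitionDiagram σ P)) := by
  let cell : ∀ n, G.V n → Set X := fun n v => {x | (T x).vtx n = v}
  have hne : ∀ n v, (cell n v).Nonempty := fun n v => by
    obtain ⟨p, hp⟩ := hG.exists_vtx_eq n v
    refine ⟨T.symm p, ?_⟩
    change (T (T.symm p)).vtx n = v
    rwa [T.apply_symm_apply]
  have hcell : ∀ n, Function.Injective (cell n) := fun n v v' e => by
    obtain ⟨x, hx⟩ := hne n v
    have hx' : x ∈ cell n v' := e ▸ hx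
    exact Eq.trans (Eq.symm hx) hx'
  have hopen : ∀ n v, IsOpen (cell n v) := fun n v => (isOpen_setOf_vtx n v).preimage T.continuous
  have hpar : ∀ n w, cell (n + 1) w ⊆ cell n (hG.bluePar n w) := by
    rintro n _ x rfl
    exact (hG.bluePar_vtx (T x) n).symm
  have hred : ∀ n w, RedSub σ n (cell (n + 1) w) (cell n (hG.redPar n w)) := by
    intro n w
    constructor
    · rintro hn y rfl
      obtain ⟨j, rfl⟩ := hn.two_dvd
      obtain ⟨x, rfl⟩ := hσ.surjective y
      exact ⟨x, (hG.mapsTo_iff'.1 (hT x) j).symm, rfl⟩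
    · rintro hn x rfl
      obtain ⟨j, rfl⟩ := hn
      exact (hG.mapsTo_iff.1 (hT x) j).symm
  have htower : IsTower σ fun n => range (cell n) := by
    refine ⟨fun n => ⟨?_, ?_, ?_, ?_, ?_⟩, ?_, ?_, ?_⟩
    · have := hG.finite_V n
      exact finite_range _
    · rintro _ ⟨v, rfl⟩
      exact hne n v
    · rintro _ ⟨v, rfl⟩
      refine ⟨⟨?_⟩, hopen n v⟩
      have : (cell n v)ᶜ = ⋃ w ∈ {w | w ≠ v}, cell n w := by
        ext x
        simp [cell]
      rw [this]
      exact isOpen_biUnion fun w _ => hopen n w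
    · rintro _ ⟨v, rfl⟩ _ ⟨w, rfl⟩ hvw
      refine disjoint_left.2 fun x hx hx' => hvw ?_
      rw [← show (T x).vtx n = v from hx, ← show (T x).vtx n = w from hx']
    · exact eq_univ_of_forall fun x => ⟨_, ⟨(T x).vtx n, rfl⟩, rfl⟩
    · rintro n _ ⟨w, rfl⟩
      exact ⟨_, ⟨_, rfl⟩, hpar n w⟩
    · rintro n _ ⟨w, rfl⟩
      exact ⟨_, ⟨_, rfl⟩, hred n w⟩
    · intro U hU x hx
      obtain ⟨n, hn⟩ := hG.isLDiagram.exists_vtx_subset (hU.preimage T.symm.continuous)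
        (x := T x) (by simpa using hx)
      refine ⟨n, _, ⟨(T x).vtx n, rfl⟩, rfl, fun y hy => ?_⟩
      have := hn (show T y ∈ _ from hy)
      simpa using this
  have hD := htower.isHDiagram hσ
  refine ⟨_, htower, hG.nonempty_iso hD (fun n => Equiv.ofInjective (cell n) (hcell n))
    (fun n w => ?_) fun n w => ?_⟩
  · exact (htower.par_blue_eq_iff hD.hasUniqueSources_blue).2 (hpar n w)
  · exact (htower.par_red_eq_iff hD.hasUniqueSources_red).2 (hred n w)

end TowerDiagram

/-! ### Contracting the diagram of a tower -/

section Interleave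

variable {X : Type u} [TopologicalSpace X] {σ : X → X} {P Q : ℕ → Set (Set X)}

theorem IsTower.comp (h : IsTower σ P) (c : ContractionSeq) : IsTower σ fun n => P (c.m n) where
  partition n := h.partition _
  refines n W hW := h.exists_superset (c.lt n).le hW
  red n W hW := by
    obtain ⟨Y, hY, hWY⟩ := h.exists_superset (Nat.succ_le_of_lt (c.lt n)) hW
    obtain ⟨Z, hZ, hYZ⟩ := h.red (c.m n) Y hY
    exact ⟨Z, hZ, (hYZ.mono hWY Subset.rfl).congr (c.mod_two n)⟩
  small U hU x hx := by
    obtain ⟨n, Z, hZ, hxZ, hZU⟩ := h.small U hU x hx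
    obtain ⟨W, hW, hxW⟩ := (h.partition (c.m n)).exists_mem x
    exact ⟨n, W, hW, hxW, (h.subset_of_le (c.le n) hW hZ hxW hxZ).trans hZU⟩

section Descend

variable (h : IsTower σ P) (hD : IsHDiagram (partitionDiagram σ P))
include h

theorem IsTower.subset_descend_blue {i j : ℕ} (hij : i ≤ j) (W : P j) :
    W.1 ⊆ (descend (V := fun n => P n) hD.bluePar W i hij).1 := by
  induction j, hij using Nat.le_induction with
  | base => exact (congrArg Subtype.val (descend_self (V := fun n => P n) hD.bluePar W)).ge
  | succ j hij ih =>
    have h₁ : W.1 ⊆ Subtype.val (p := (· ∈ P j)) (hD.bluePar j W) :=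
      (h.par_blue_eq_iff hD.hasUniqueSources_blue).1 rfl
    exact (h₁.trans (ih _)).trans (congrArg Subtype.val
      (descend_succ (V := fun n => P n) hD.bluePar W hij)).ge

theorem IsTower.redSub_descend_red {i j : ℕ} (hij : i < j) (ho : Odd (j - i)) (W : P j) :
    RedSub σ i W.1 (descend (V := fun n => P n) hD.redPar W i hij.le).1 := by
  obtain ⟨k, rfl⟩ : ∃ k, j = k + 1 := ⟨j - 1, by omega⟩
  have hik : i ≤ k := Nat.le_of_lt_succ hij
  have hpar : k % 2 = i % 2 := by
    rw [Nat.odd_iff] at ho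
    omega
  have h₁ : RedSub σ k W.1 (Subtype.val (p := (· ∈ P k)) (hD.redPar k W)) :=
    (h.par_red_eq_iff hD.hasUniqueSources_red).1 rfl
  have h₂ := h.subset_descend_blue hD hik (hD.redPar k W)
  have h₃ := descend_eq_of_even (V := fun n => P n) hD.bluePar hD.redPar hD.bluePar_bluePar hik
    (by rw [Nat.even_iff]; omega) (hD.redPar k W)
  have h₄ := descend_succ (V := fun n => P n) hD.redPar W hik
  rw [h₄, ← h₃]
  exact (h₁.mono Subset.rfl h₂).congr hpar

/-- The contraction of the diagram of a tower is the diagram of a subsequence of the tower. -/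
theorem IsTower.nonempty_iso_contract [Nonempty X] (hσ : Function.Bijective σ)
    (c : ContractionSeq) :
    Nonempty (((partitionDiagram σ P).contract c).Iso
      (partitionDiagram σ fun n => P (c.m n))) := by
  have hD := h.isHDiagram hσ
  have hc := (h.comp c).isHDiagram hσ
  refine (hD.contract c).nonempty_iso hc (fun n => Equiv.refl (P (c.m n)))
    (fun n W => ?_) fun n W => ?_
  · refine ((h.comp c).par_blue_eq_iff hc.hasUniqueSources_blue).2 ?_
    refine (h.subset_descend_blue hD (c.lt n).le W).trans (congrArg Subtype.val
      (hD.par_blue_contract c (hD.contract c).hasUniqueSources_blue n W)).ge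
  · refine ((h.comp c).par_red_eq_iff hc.hasUniqueSources_red).2 ?_
    have hodd : Odd (c.m (n + 1) - c.m n) := by
      have h₁ := c.mod_two n
      have h₂ := c.mod_two (n + 1)
      have h₃ := c.lt n
      rw [Nat.odd_iff]
      omega
    have h₁ := (h.redSub_descend_red hD (c.lt n) hodd W).congr (c.mod_two n)
    exact h₁.mono Subset.rfl (congrArg Subtype.val
      (hD.par_red_contract c (hD.contract c).hasUniqueSources_red n W)).ge

end Descend

theorem HDiag.equiv_of_iso {F G : HDiag.{u}} (h : Nonempty (F.1.Iso G.1)) : F ≈ G :=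
  Relation.EqvGen.rel F.toLDiag G.toLDiag (Or.inl h)

theorem HDiag.contract_equiv (F : HDiag.{u}) (c : ContractionSeq) :
    F ≈ ⟨F.1.contract c, F.2.contract c⟩ :=
  Relation.EqvGen.rel F.toLDiag (HDiag.toLDiag ⟨F.1.contract c, F.2.contract c⟩)
    (Or.inr ⟨c, rfl⟩)

/-- The `h`-diagram of a tower. -/
def IsTower.hDiag [Nonempty X] (h : IsTower σ P) (hσ : Function.Bijective σ) : HDiag.{u} :=
  ⟨partitionDiagram σ P, h.isHDiagram hσ⟩

theorem IsTower.hDiag_comp [Nonempty X] (h : IsTower σ P) (hσ : Function.Bijective σ)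
    (c : ContractionSeq) : h.hDiag hσ ≈ (h.comp c).hDiag hσ :=
  Setoid.trans ((h.hDiag hσ).contract_equiv c)
    (HDiag.equiv_of_iso (h.nonempty_iso_contract hσ c))

/-! ### Interleaving two towers -/

/-- Every partition is refined, together with its image and its preimage, by a late partition of
a tower whose index has prescribed parity. -/
theorem IsTower.exists_refinesBoth [CompactSpace X] (h : IsTower σ P) (hσ : IsHomeomorph σ)
    {A : Set (Set X)} (hA : IsClopenPartition A) (a : ℕ) :
    ∃ b, a < b ∧ b % 2 = (a + 1) % 2 ∧ RefinesBoth σ A (P b) := by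
  choose U hU hx h₁ h₂ h₃ using hA.exists_nhd hσ
  obtain ⟨N, hN⟩ := h.exists_subordinate U hU hx
  refine ⟨a + 1 + 2 * N, by omega, by omega, fun W hW => ?_⟩
  obtain ⟨x, hWU⟩ := hN _ (by omega) W hW
  exact ⟨(h₁ x).imp fun Z hZ => ⟨hZ.1, hWU.trans hZ.2⟩,
    (h₂ x).imp fun Z hZ => ⟨hZ.1, hWU.trans hZ.2⟩,
    (h₃ x).imp fun Z hZ => ⟨hZ.1, hWU.trans hZ.2⟩⟩

/-- Two towers for the same map have equivalent diagrams: a third tower runs through members of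
both, and both diagrams contract to contractions of its diagram. -/
theorem IsTower.hDiag_equiv [Nonempty X] [CompactSpace X] (hσ : IsHomeomorph σ)
    (hP : IsTower σ P) (hQ : IsTower σ Q) : hP.hDiag hσ.bijective ≈ hQ.hDiag hσ.bijective := by
  -- The gaps of a contraction are odd, so `P` and `Q` cannot alternate; `Q` is used at the
  -- places `3k + 2`, and `P` at all others, in particular at the places `3k`.
  let A : ℕ → ℕ → Set (Set X) := fun n => if n % 3 = 2 then Q else P
  have hA : ∀ n, IsTower σ (A n) := fun n => by
    dsimp only [A]
    split_ifs
    exacts [hQ, hP]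
  obtain ⟨m, hm₀, hm⟩ := exists_seq_of_forall_exists 0
    (fun n a b => a < b ∧ b % 2 = (a + 1) % 2 ∧ RefinesBoth σ (A n a) (A (n + 1) b))
    fun n a => (hA (n + 1)).exists_refinesBoth hσ ((hA n).partition a) a
  have hmono : StrictMono m := strictMono_nat_of_lt_succ fun n => (hm n).1
  have hmod : ∀ n, m n % 2 = n % 2 := by
    intro n
    induction n with
    | zero => rw [hm₀]
    | succ n ih =>
      have := (hm n).2.1
      omega
  have hR : IsTower σ fun n => A n (m n) := by
    refine ⟨fun n => (hA n).partition _, fun n W hW => ((hm n).2.2 W hW).1,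
      fun n W hW => (hm n).2.2.redSub n hW, fun U hU x hx => ?_⟩
    obtain ⟨n, Z, hZ, hxZ, hZU⟩ := hP.small U hU x hx
    obtain ⟨W, hW, hxW⟩ := (hP.partition (m (3 * n))).exists_mem x
    have hAP : A (3 * n) = P := if_neg (by omega)
    refine ⟨3 * n, W, ?_, hxW, (hP.subset_of_le ?_ hW hZ hxW hxZ).trans hZU⟩
    · rwa [hAP]
    · have : 3 * n ≤ m (3 * n) := hmono.le_apply
      omega
  have hseq : ∀ (f : ℕ → ℕ), StrictMono f → (∀ n, f n % 2 = n % 2) →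
      ∃ c : ContractionSeq, c.m = f := fun f hf hf₂ =>
    ⟨⟨f, hf, by rw [Nat.even_iff, hf₂], fun n => by
      have h₁ := hf₂ n
      have h₂ := hf₂ (n + 1)
      have h₃ : f n < f (n + 1) := hf n.lt_succ_self
      rw [Nat.ModEq]
      omega⟩, rfl⟩
  -- For even `r`, the places `3k + r` are a contraction sequence.
  have key : ∀ (S : ℕ → Set (Set X)) (hS : IsTower σ S) (r : ℕ), r % 2 = 0 →
      (∀ k, A (3 * k + r) = S) → hS.hDiag hσ.bijective ≈ hR.hDiag hσ.bijective := by
    intro S hS r hr hAS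
    have hlin : StrictMono fun k => 3 * k + r := strictMono_nat_of_lt_succ fun k => by omega
    obtain ⟨c, hc⟩ := hseq (fun k => 3 * k + r) hlin fun n => by omega
    obtain ⟨d, hd⟩ := hseq (fun k => m (3 * k + r)) (hmono.comp hlin) fun n => by
      rw [hmod]
      omega
    have e : (fun n => S (d.m n)) = fun n => A (c.m n) (m (c.m n)) := by
      funext n
      rw [hc, hd, hAS]
    have h₁ := hS.hDiag_comp hσ.bijective d
    have h₂ := hR.hDiag_comp hσ.bijective c
    have h₃ : (hS.comp d).hDiag hσ.bijective = (hR.comp c).hDiag hσ.bijective :=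
      Subtype.ext (congrArg (partitionDiagram σ) e)
    rw [h₃] at h₁
    exact Setoid.trans h₁ (Setoid.symm h₂)
  exact Setoid.trans (key P hP 0 rfl fun k => if_neg (by omega))
    (Setoid.symm (key Q hQ 2 rfl fun k => if_pos (by omega)))

end Interleave

/-! ### The correspondence between classes -/

/-- The system of the diagram of a tower is conjugate to the given system. -/
theorem Homeo.toHomeo_hDiag_equiv (S : Homeo.{u}) {P : ℕ → Set (Set S.1.X)}
    (hP : IsTower S.1.σ P) (hD : IsHDiagram (partitionDiagram S.1.σ P)) :
    HDiag.toHomeo ⟨partitionDiagram S.1.σ P, hD⟩ ≈ S := by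
  have := S.1.isLHomeo.compact
  have := S.1.isLHomeo.metrizable
  obtain ⟨T, hT⟩ := hP.exists_homeomorph hD
  exact Setoid.symm (show S ≈ HDiag.toHomeo ⟨partitionDiagram S.1.σ P, hD⟩ from
    ⟨T, funext fun x => (hD.mapsTo_iff_eq _ _).1 (hT x)⟩)

/-- `h`-diagrams with conjugate systems are equivalent. -/
theorem HDiag.equiv_of_toHomeo_equiv {F G : HDiag.{u}} (h : F.toHomeo ≈ G.toHomeo) : F ≈ G := by
  obtain ⟨T, hT⟩ := h
  change F.1.PathSpace ≃ₜ G.1.PathSpace at T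
  have hL := F.2.isLHomeo_pathHomeo
  have := hL.nonempty
  have := hL.compact
  have hσ := F.2.pathHomeo.isHomeomorph
  obtain ⟨P, hP, hPF⟩ := exists_isTower_iso hσ.bijective F.2 (Homeomorph.refl _)
    fun x => (F.2.mapsTo_iff_eq _ _).2 rfl
  obtain ⟨Q, hQ, hQG⟩ := exists_isTower_iso hσ.bijective G.2 T
    fun x => (G.2.mapsTo_iff_eq _ _).2 (congrFun hT x)
  have h₁ : F ≈ hP.hDiag hσ.bijective := HDiag.equiv_of_iso hPF
  have h₂ : G ≈ hQ.hDiag hσ.bijective := HDiag.equiv_of_iso hQG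
  exact Setoid.trans h₁ (Setoid.trans (hP.hDiag_equiv hσ hQ) (Setoid.symm h₂))

/-- Passing from an `h`-diagram to its system is a bijection between classes. -/
noncomputable def classEquiv : Quotient HDiag.setoid.{u} ≃ Quotient Homeo.setoid.{u} :=
  Equiv.ofBijective (Quotient.map HDiag.toHomeo fun _ _ => HDiag.toHomeo_equiv) <| by
    constructor
    · rintro ⟨F⟩ ⟨G⟩ h
      exact Quotient.sound (HDiag.equiv_of_toHomeo_equiv (Quotient.exact h))
    · rintro ⟨S⟩
      have := S.1.isLHomeo.nonempty
      have := S.1.isLHomeo.compact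
      have := S.1.isLHomeo.metrizable
      have := S.1.isLHomeo.totallyDisconnected
      obtain ⟨P, hP⟩ := exists_isTower S.2
      exact ⟨Quotient.mk _ (hP.hDiag S.2.bijective),
        Quotient.sound (S.toHomeo_hDiag_equiv hP (hP.isHDiagram S.2.bijective))⟩

end Diagrams

theorem theorem4p7 :
    -- every homeomorphism admits a refined sequence of partitions
    (∀ S : Homeo.{u}, ∃ P : ℕ → Set (Set S.1.X),
      haveI := S.1.isLHomeo.metrizable
      IsRefinedSeq S.1.σ P) ∧
    ∃ Φ : Quotient Homeo.setoid.{u} ≃ Quotient HDiag.setoid.{u},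
      -- `Φ` is induced by the construction of a diagram from a refined sequence of partitions
      (∀ (S : Homeo.{u}) (P : ℕ → Set (Set S.1.X)),
        haveI := S.1.isLHomeo.metrizable
        IsRefinedSeq S.1.σ P →
          ∃ h : IsHDiagram (partitionDiagram S.1.σ P),
            Φ (Quotient.mk _ S) = Quotient.mk _ ⟨partitionDiagram S.1.σ P, h⟩) ∧
      -- the inverse of `Φ` is induced by the construction of a map on the infinite blue paths
      (∀ F : HDiag.{u}, ∃ (φ : F.1.PathSpace → F.1.PathSpace) (hL : IsLHomeo F.1.PathSpace φ)
        (hφ : IsHomeomorph φ), (∀ x y, F.1.MapsTo x y ↔ y = φ x) ∧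
          Φ.symm (Quotient.mk _ F) = Quotient.mk _ ⟨⟨F.1.PathSpace, φ, hL⟩, hφ⟩) := by
  refine ⟨fun S => ?_, classEquiv.symm, fun S P => ?_, fun F => ?_⟩
  · have := S.1.isLHomeo.nonempty
    have := S.1.isLHomeo.compact
    have := S.1.isLHomeo.metrizable
    have := S.1.isLHomeo.totallyDisconnected
    obtain ⟨P, hP⟩ := exists_isTower S.2
    exact ⟨P, hP.isRefinedSeq S.2⟩
  · intro hP
    have := S.1.isLHomeo.nonempty
    have := S.1.isLHomeo.metrizable
    have hT := hP.isTower
    refine ⟨hT.isHDiagram S.2.bijective, ?_⟩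
    rw [Equiv.symm_apply_eq]
    exact (Quotient.sound (S.toHomeo_hDiag_equiv hT _)).symm
  · exact ⟨F.2.pathHomeo, F.2.isLHomeo_pathHomeo, F.2.pathHomeo.isHomeomorph,
      F.2.mapsTo_iff_eq, rfl⟩
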